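/- **Setting.** A binary memoryless symmetric (BMS) channel $W$ has input alphabet $\{\pm1\}$, a measurable output space $\mathcal Y$, and output laws $W(\cdot\mid +),W(\cdot\mid -)$ such that for some measurable involution $s:\mathcal Y\to\mathcal Y$ one has $W(s^{-1}(E)\mid +)=W(E\mid -)$ for all measurable $E\subseteq\mathcal Y$. For a uniform input $X$ with output $Y$, let $\Delta=\min_{x=\pm1}\mathbb P[X=x\mid Y]\in[0,\tfrac12]$, and put $P_e(W)=\mathbb E\,\Delta$ (probability of error) and $Z(W)=\mathbb E\big[2\sqrt{\Delta(1-\Delta)}\big]$ (Bhattacharyya coefficient). Let $\delta\in(0,\tfrac12]$ and $\theta=1-2\delta$. Let $T$ be a rooted tree with root $\rho$, either the $d$-regular tree, in which every vertex has exactly $d$ children, or a Galton–Watson tree with Poisson$(d)$ offspring distribution ($d\ge 0$ real). Let $L_k$ and $T_k$ be the sets of vertices at level $k$ and at level at most $k$ (the root has level $0$). The root spin $\sigma_\rho$ is uniform on $\{\pm1\}$, independently of $T$, and is broadcast down $T$: the spin of a child equals that of its parent with probability $1-\delta$ and is the opposite with probability $\delta$, independently over the edges. Given $T$ and all the spins,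 each vertex $u$ (the root included) carries an independent observation $\omega_u\sim W(\cdot\mid\sigma_u)$. Write $\sigma_{L_k}=(\sigma_u)_{u\in L_k}$ and $\omega_{T_k}=(\omega_u)_{u\in T_k}$. *Boundary irrelevance* (BI) means $$\lim_{k\to\infty} I(\sigma_\rho;\sigma_{L_k}\mid T,\omega_{T_k})=0 ,$$ where $I$ is conditional mutual information. **Theorem.** Let $W$ be a BMS channel with $P_e(W)\neq\frac12$. If $$ d\theta^2\,\exp\!\Big(-\frac{(d\theta^2-1)_+}{2}\Big)\,Z(W)<1 ,$$ where $x_+=\max(x,0)$, then (BI) holds. In particular, for every BMS channel $W$ with $P_e(W)\ne\frac12$, (BI) holds whenever $d\theta^2<1$ or $d\theta^2>\alpha^*$, where $\alpha^*\approx3.513$ is the unique solution in $(1,\infty)$ of $\alpha\exp\!\big(-\frac{\alpha-1}{2}\big)=1$. -/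

import Mathlib

open MeasureTheory ProbabilityTheory Filter Topology
open scoped NNReal ENNReal

namespace BOTS

noncomputable section

/-! ### Binary memoryless symmetric channels

The spins `{+1, -1}` are the units of `ℤ`.  A channel with input in `{±1}` and output in `𝒴` is a
Markov kernel from `ℤˣ` to `𝒴`. -/

/-- A binary-input channel is symmetric (BMS) if some measurable involution of the output alphabet
exchanges the two output distributions. -/
def IsBMS {𝒴 : Type*} [MeasurableSpace 𝒴] (W : Kernel ℤˣ 𝒴) : Prop :=
  ∃ s : 𝒴 → 𝒴, Measurable s ∧ Function.Involutive s ∧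
    ∀ E : Set 𝒴, MeasurableSet E → W 1 (s ⁻¹' E) = W (-1) E

/-- The law of the output of the channel `W` when the input is uniform on `{±1}`. -/
def outputLaw {𝒴 : Type*} [MeasurableSpace 𝒴] (W : Kernel ℤˣ 𝒴) : Measure 𝒴 :=
  (2⁻¹ : ℝ≥0∞) • (W 1 + W (-1))

/-- The posterior probability `ℙ[X = x | Y = y]` for a uniform input `X` of the channel `W`
with output `Y`: one half of the density of `W x` with respect to the output law. -/
def posterior {𝒴 : Type*} [MeasurableSpace 𝒴] (W : Kernel ℤˣ 𝒴) (x : ℤˣ) (y : 𝒴) : ℝ :=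
  ((W x).rnDeriv (outputLaw W) y).toReal / 2

/-- The `Δ`-component of the channel `W` as a function of the output: the posterior probability of
the less likely input.  Under the output law (for a BMS channel, also under each `W x`) this has
the law of the parameter `Δ ∈ [0, 1/2]` of the standard form
`X ↦ (Δ, BSC_Δ(X))` of the channel. -/
def deltaComponent {𝒴 : Type*} [MeasurableSpace 𝒴] (W : Kernel ℤˣ 𝒴) (y : 𝒴) : ℝ :=
  min (posterior W 1 y) (posterior W (-1) y)

/-- The law on `ℝ` of the `Δ`-component of the channel `W`. -/
def deltaLaw {𝒴 : Type*} [MeasurableSpace 𝒴] (W : Kernel ℤˣ 𝒴) : Measure ℝ :=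
  (outputLaw W).map (deltaComponent W)

/-- The probability of error `P_e(W) = 𝔼 Δ`. -/
def probError {𝒴 : Type*} [MeasurableSpace 𝒴] (W : Kernel ℤˣ 𝒴) : ℝ :=
  ∫ x, x ∂(deltaLaw W)

/-- The Bhattacharyya coefficient `Z(W) = 𝔼 [2 √(Δ (1 - Δ))]`. -/
def bhattacharyya {𝒴 : Type*} [MeasurableSpace 𝒴] (W : Kernel ℤˣ 𝒴) : ℝ :=
  ∫ x, 2 * Real.sqrt (x * (1 - x)) ∂(deltaLaw W)

/-! ### Conditional mutual information of a finite-valued random variable (in nats) -/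

/-- The conditional entropy `H(X | Z) = 𝔼 [∑ₓ -ℙ(X = x | Z) log ℙ(X = x | Z)]` of a random
variable `X` with finitely many values given an arbitrary random variable `Z`. -/
def condEntropy {Ω α ζ : Type*} [MeasurableSpace Ω] [Fintype α] [mζ : MeasurableSpace ζ]
    (P : Measure Ω) (X : Ω → α) (Z : Ω → ζ) : ℝ :=
  ∫ a, ∑ x : α, Real.negMulLog ((P⟦X ⁻¹' {x} | mζ.comap Z⟧) a) ∂P

/-- The conditional mutual information `I(X; Y | Z) = H(X | Z) - H(X | Y, Z)` of a random variable
`X` with finitely many values and arbitrary random variables `Y` and `Z`. -/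
def condMutualInfo {Ω α η ζ : Type*} [MeasurableSpace Ω] [Fintype α] [MeasurableSpace η]
    [MeasurableSpace ζ] (P : Measure Ω) (X : Ω → α) (Y : Ω → η) (Z : Ω → ζ) : ℝ :=
  condEntropy P X Z - condEntropy P X (fun a => (Y a, Z a))

/-! ### Random rooted trees

The possible nodes are the finite sequences of natural numbers.  The root is `[]`, and
`i :: u` is the `i`-th child of `u`, so that the level of a node is its length. -/

/-- A rooted tree, given by the number of children of each potential node. -/
abbrev Tree : Type := List ℕ → ℕ

/-- The node `u` belongs to the tree `T`: the root does, and `i :: u` does if and only if `u` does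
and has more than `i` children. -/
def IsNode (T : Tree) : List ℕ → Prop
  | [] => True
  | i :: u => i < T u ∧ IsNode T u

/-- The two kinds of trees: every node has exactly `d` children, or the numbers of children are
independent Poisson variables with mean `d`. -/
inductive TreeModel : Type
  | regular (d : ℕ) : TreeModel
  | poissonGaltonWatson (d : ℝ≥0) : TreeModel

/-- The parameter `d` of the model: the mean number of children of a node. -/
def TreeModel.degree : TreeModel → ℝ
  | .regular d => d
  | .poissonGaltonWatson d => d

/-- The law of the tree. -/
def TreeModel.law : TreeModel → Measure Tree
  | .regular d => Measure.dirac (fun _ => d)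
  | .poissonGaltonWatson d => Measure.infinitePi (fun _ : List ℕ => poissonMeasure d)

/-! ### Broadcasting on a tree with survey

All the randomness is generated by independent sources: the tree, the uniform root spin, for each
potential node `i :: u` the sign `-1` (with probability `δ`) or `1` (with probability `1 - δ`) by
which the spin changes along the edge from `u` to `i :: u`, and for each potential node `u` and each
spin `s` an output of the channel `W` for the input `s`. -/

/-- The sample space: tree, root spin, edge signs, channel outputs. -/
abbrev Sample (𝒴 : Type*) : Type _ :=
  Tree × ℤˣ × (List ℕ → ℤˣ) × (List ℕ × ℤˣ → 𝒴)

/-- The law of a sign that equals `-1` with probability `δ` and `1` with probability `1 - δ`. -/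
def signLaw (δ : ℝ) : Measure ℤˣ :=
  ENNReal.ofReal δ • Measure.dirac (-1) + ENNReal.ofReal (1 - δ) • Measure.dirac 1

/-- The probability measure on the sample space. -/
def botsMeasure {𝒴 : Type*} [MeasurableSpace 𝒴] (M : TreeModel) (δ : ℝ) (W : Kernel ℤˣ 𝒴) :
    Measure (Sample 𝒴) :=
  M.law.prod ((signLaw (1 / 2)).prod
    ((Measure.infinitePi fun _ : List ℕ => signLaw δ).prod
      (Measure.infinitePi fun p : List ℕ × ℤˣ => W p.2)))

/-- The spin `σ_u`: the root spin times the signs of the edges between the root and `u`. -/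
def spin {𝒴 : Type*} (a : Sample 𝒴) : List ℕ → ℤˣ
  | [] => a.2.1
  | i :: u => spin a u * a.2.2.1 (i :: u)

/-- The survey `ω_u`: given the spins, these are independent with laws `W (σ_u)`. -/
def survey {𝒴 : Type*} (a : Sample 𝒴) (u : List ℕ) : 𝒴 :=
  a.2.2.2 (u, spin a u)

open Classical in
/-- The family `(x_u)` restricted to a set `S` of nodes, with a blank symbol outside of `S`. -/
def restrictTo {E : Type*} (S : Set (List ℕ)) (x : List ℕ → E) (u : List ℕ) : Unit ⊕ E :=
  if u ∈ S then Sum.inr (x u) else Sum.inl ()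

/-- The set `L_k` of the nodes of the tree at level `k`. -/
def levelSet (T : Tree) (k : ℕ) : Set (List ℕ) := {u | IsNode T u ∧ u.length = k}

/-- The set `T_k` of the nodes of the tree at level at most `k`. -/
def truncation (T : Tree) (k : ℕ) : Set (List ℕ) := {u | IsNode T u ∧ u.length ≤ k}

/-- The root spin `σ_ρ`. -/
def rootSpin {𝒴 : Type*} (a : Sample 𝒴) : ℤˣ := spin a []

/-- The spins `σ_{L_k}` of the nodes at level `k`. -/
def levelSpins {𝒴 : Type*} (k : ℕ) (a : Sample 𝒴) : List ℕ → Unit ⊕ ℤˣ :=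
  restrictTo (levelSet a.1 k) (spin a)

/-- The tree `T` together with the survey `ω_{T_k}` of the nodes at level at most `k`. -/
def treeAndSurvey {𝒴 : Type*} (k : ℕ) (a : Sample 𝒴) : Tree × (List ℕ → Unit ⊕ 𝒴) :=
  (a.1, restrictTo (truncation a.1 k) (survey a))

/-! ### The variables above are measurable and the measure above is a probability measure -/

instance : DiscreteMeasurableSpace ℤˣ where
  forall_measurableSet s := ⟨Units.val '' s, trivial, Set.preimage_image_eq _ Units.val_injective⟩

theorem measurableSet_isNode (u : List ℕ) : MeasurableSet {T : Tree | IsNode T u} := by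
  induction u with
  | nil => simp [IsNode]
  | cons i u ih =>
    have h : Measurable fun T : Tree => T u := measurable_pi_apply u
    exact (measurableSet_lt measurable_const h).inter ih

theorem measurable_spin {𝒴 : Type*} [MeasurableSpace 𝒴] (u : List ℕ) :
    Measurable fun a : Sample 𝒴 => spin a u := by
  induction u with
  | nil => exact measurable_snd.fst
  | cons i u ih =>
    have h : Measurable fun a : Sample 𝒴 => a.2.2.1 (i :: u) :=
      (measurable_pi_apply _).comp measurable_snd.snd.fst
    exact (Measurable.of_discrete (f := fun p : ℤˣ × ℤˣ => p.1 * p.2)).comp (ih.prodMk h)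

theorem measurable_survey {𝒴 : Type*} [MeasurableSpace 𝒴] (u : List ℕ) :
    Measurable fun a : Sample 𝒴 => survey a u := by
  have h : Measurable fun q : ℤˣ × (List ℕ × ℤˣ → 𝒴) => q.2 (u, q.1) :=
    measurable_from_prod_countable_right fun s => measurable_pi_apply (u, s)
  exact h.comp ((measurable_spin u).prodMk measurable_snd.snd.snd)

theorem measurable_levelSpins {𝒴 : Type*} [MeasurableSpace 𝒴] (k : ℕ) :
    Measurable (levelSpins k : Sample 𝒴 → _) := by
  refine measurable_pi_lambda _ fun u => ?_
  refine Measurable.ite ?_ (measurable_inr.comp (measurable_spin u)) measurable_const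
  exact measurable_fst ((measurableSet_isNode u).inter (.const _))

theorem measurable_treeAndSurvey {𝒴 : Type*} [MeasurableSpace 𝒴] (k : ℕ) :
    Measurable (treeAndSurvey k : Sample 𝒴 → _) := by
  refine measurable_fst.prodMk (measurable_pi_lambda _ fun u => ?_)
  refine Measurable.ite ?_ (measurable_inr.comp (measurable_survey u)) measurable_const
  exact measurable_fst ((measurableSet_isNode u).inter (.const _))

theorem isProbabilityMeasure_signLaw {δ : ℝ} (h0 : 0 ≤ δ) (h1 : δ ≤ 1) :
    IsProbabilityMeasure (signLaw δ) := ⟨by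
  simp [signLaw, ← ENNReal.ofReal_add h0 (sub_nonneg.2 h1)]⟩

instance (M : TreeModel) : IsProbabilityMeasure M.law := by
  cases M <;> (unfold TreeModel.law; infer_instance)

theorem isProbabilityMeasure_botsMeasure {𝒴 : Type*} [MeasurableSpace 𝒴] (M : TreeModel) {δ : ℝ}
    (h0 : 0 ≤ δ) (h1 : δ ≤ 1) (W : Kernel ℤˣ 𝒴) [IsMarkovKernel W] :
    IsProbabilityMeasure (botsMeasure M δ W) := by
  have := isProbabilityMeasure_signLaw h0 h1
  have := isProbabilityMeasure_signLaw (δ := 1 / 2) (by norm_num) (by norm_num)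
  unfold botsMeasure
  infer_instance

/-- Boundary irrelevance: `I(σ_ρ; σ_{L_k} | T, ω_{T_k}) → 0` as `k → ∞`. -/
def BoundaryIrrelevance {𝒴 : Type*} [MeasurableSpace 𝒴] (M : TreeModel) (δ : ℝ)
    (W : Kernel ℤˣ 𝒴) : Prop :=
  Tendsto (fun k : ℕ => condMutualInfo (botsMeasure M δ W) rootSpin (levelSpins k)
    (treeAndSurvey k)) atTop (𝓝 0)

end

end BOTS

/-!
# Boundary irrelevance for broadcasting on trees with survey

Everything is expressed through the *bias* `x = 𝔼[σ | output] ∈ [-1, 1]` of a binary experiment, a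
kernel `K` from the spins to some space of outputs, with uniform input (`bias`, `biasMean`). The
Bhattacharyya coefficient of `K` is `Z = 𝔼 √(1 - x²)` (`bhattacharyya_eq_biasMean`), and the
conditional entropy of the spin is `𝔼 h((1 + x) / 2)` with the binary entropy `h`
(`condEntropy_eq_biasMean`). If an experiment is degraded, i.e. some of its output is forgotten, its
bias is replaced by a conditional expectation, so that by Jensen's inequality the mean of a convex
function of the bias decreases (`biasMean_map_le`).

Let `L k` be the experiment that observes, at the root, the tree, the survey up to level `k` and the
spins at level `k`, and let `K k` be its degradation that forgets these spins. Since
`h((1 + x) / 2) - √(1 - x²)` is convex, the mutual information in question is squeezed between `0`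
and the gap `D k = Z(K k) - Z(L k)`, and it suffices that `D k → 0`.

Both sequences obey the same recursion (`IsStep`, `isStep_survey`, `isStep_level`): the next
experiment combines the survey at the root with independent noisy copies of the present one, one for
each child of the root. Since the Bhattacharyya coefficient is multiplicative over conditionally
independent observations, `Z(K (k + 1)) = Z(W) G(a k)`, where `G` is the generating function of the
offspring law and `a k = 𝔼 √(1 - θ² x²)`; in the same way `Z(L (k + 1)) = Z(W) G(b k)`. Since
`√(1 - θ² x²) - θ² √(1 - x²)` is convex, `a k - b k ≤ θ² D k`. Moreover
`G(a) - G(b) ≤ d exp(-κ (1 - a)) (a - b)`, where `κ` is the mean number of siblings of a node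
(`TreeModel.genFun_sub_le`), and `1 - a k ≥ θ² C k / 2` with `C k = 𝔼 x²`, the mean being taken for
`K k`. Writing `α = d θ²` and `u k = κ θ² C k`, one arrives at
`D (k + 1) ≤ Z(W) α exp(-u k / 2) D k`.

It remains to bound `u` from below. Estimating the root spin by the optimal multiple of the sum of
the biases of the children yields `u (k + 1) ≥ α u k / (1 + u k)` (`IsStep.le_biasMean_sq`). If
`α > 1`, then `u 0 > 0` because `P_e(W) ≠ 1 / 2`, and the Möbius map on the right drives `u` above
any level below its fixed point `α - 1` (`eventually_le_of_mobius_recursion`). Hence the contraction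
factor of `D` is eventually less than `1` if `α exp(-(α - 1)₊ / 2) Z(W) < 1`
(`tendsto_biasMean_sqrt_sub`).

The consequences for `d θ² < 1` and `d θ² > α*` follow from `Z(W) ≤ 1` and from the strict concavity
of the logarithm, which controls the sign of `log x - (x - 1) / 2`.
-/

namespace BOTS

/-! ### Binary experiments -/

noncomputable section

variable {ζ : Type*} [MeasurableSpace ζ]

/-- The numerical value `±1` of a spin. -/
def sgn (s : ℤˣ) : ℝ := ((s : ℤ) : ℝ)

@[simp] theorem sgn_one : sgn 1 = 1 := by simp [sgn]
@[simp] theorem sgn_neg_one : sgn (-1) = -1 := by simp [sgn]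
theorem sgn_neg (s : ℤˣ) : sgn (-s) = -sgn s := by simp [sgn]

theorem abs_sgn (s : ℤˣ) : |sgn s| = 1 := by
  rcases Int.units_eq_one_or s with rfl | rfl <;> simp

theorem sgn_mul_self (s : ℤˣ) : sgn s * sgn s = 1 := by
  rcases Int.units_eq_one_or s with rfl | rfl <;> simp

theorem one_add_sgn_mul_nonneg (s : ℤˣ) {x : ℝ} (hx : |x| ≤ 1) : 0 ≤ 1 + sgn s * x := by
  have := abs_le.1 hx
  rcases Int.units_eq_one_or s with rfl | rfl <;> simp <;> linarith

theorem two_mul_outputLaw (K : Kernel ℤˣ ζ) : (2 : ℝ≥0∞) • outputLaw K = K 1 + K (-1) := by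
  rw [outputLaw, smul_smul, ENNReal.mul_inv_cancel (by simp) (by simp), one_smul]

theorem absolutelyContinuous_outputLaw (K : Kernel ℤˣ ζ) (s : ℤˣ) : K s ≪ outputLaw K := by
  have h : K s ≪ K 1 + K (-1) := by
    rcases Int.units_eq_one_or s with rfl | rfl
    · exact Measure.le_add_right le_rfl |>.absolutelyContinuous
    · exact Measure.le_add_left le_rfl |>.absolutelyContinuous
  exact h.smul_right (by simp)

instance (K : Kernel ℤˣ ζ) [IsMarkovKernel K] : IsProbabilityMeasure (outputLaw K) := ⟨by
  simp [outputLaw, ENNReal.inv_two_add_inv_two]⟩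

theorem measurable_posterior (K : Kernel ℤˣ ζ) (s : ℤˣ) : Measurable (posterior K s) := by
  unfold posterior; fun_prop

/-- The bias of a binary experiment `K`: the conditional expectation of a uniform input given the
output.  It is truncated to `[-1, 1]`, which changes it on a null set only. -/
def bias (K : Kernel ℤˣ ζ) (y : ζ) : ℝ :=
  max (-1) (min 1 (posterior K 1 y - posterior K (-1) y))

theorem abs_bias_le (K : Kernel ℤˣ ζ) (y : ζ) : |bias K y| ≤ 1 := by
  rw [bias, abs_le]; exact ⟨le_max_left _ _, max_le (by norm_num) (min_le_left _ _)⟩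

theorem measurable_bias (K : Kernel ℤˣ ζ) : Measurable (bias K) := by
  have := measurable_posterior K
  unfold bias
  fun_prop

/-- The mean of a function `φ` of the bias of a binary experiment. -/
def biasMean (φ : ℝ → ℝ) (K : Kernel ℤˣ ζ) : ℝ := ∫ y, φ (bias K y) ∂outputLaw K

/-- An experiment whose conditional laws have densities `1 ± b` with respect to a probability
measure `ρ` has output law `ρ` and posterior probabilities `(1 ± b) / 2`. -/
theorem posterior_ae_eq_of_withDensity (K : Kernel ℤˣ ζ) (ρ : Measure ζ)
    [IsFiniteMeasure ρ] {b : ζ → ℝ} (hb : Measurable b) (hb1 : ∀ y, |b y| ≤ 1)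
    (hK : ∀ s, K s = ρ.withDensity fun y => ENNReal.ofReal (1 + sgn s * b y)) :
    outputLaw K = ρ ∧ ∀ s, posterior K s =ᵐ[ρ] fun y => (1 + sgn s * b y) / 2 := by
  have hR : outputLaw K = ρ := by
    rw [outputLaw, hK 1, hK (-1), ← withDensity_add_left (by fun_prop)]
    have : ((fun y => ENNReal.ofReal (1 + sgn 1 * b y)) +
        fun y => ENNReal.ofReal (1 + sgn (-1) * b y)) = fun _ => (2 : ℝ≥0∞) := by
      ext y
      rw [Pi.add_apply, ← ENNReal.ofReal_add (one_add_sgn_mul_nonneg _ (hb1 y))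
        (one_add_sgn_mul_nonneg _ (hb1 y))]
      simp only [sgn_one, sgn_neg_one]
      rw [show 1 + 1 * b y + (1 + -1 * b y) = 2 by ring]
      simp
    rw [this, withDensity_const, smul_smul, ENNReal.inv_mul_cancel (by simp) (by simp), one_smul]
  refine ⟨hR, fun s => ?_⟩
  have h := Measure.rnDeriv_withDensity ρ
    (f := fun y => ENNReal.ofReal (1 + sgn s * b y)) (by fun_prop)
  filter_upwards [h] with y hy
  rw [posterior, hR, hK s, hy, ENNReal.toReal_ofReal (one_add_sgn_mul_nonneg _ (hb1 y))]

theorem bias_ae_eq_of_withDensity (K : Kernel ℤˣ ζ) (ρ : Measure ζ) [IsFiniteMeasure ρ]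
    {b : ζ → ℝ} (hb : Measurable b) (hb1 : ∀ y, |b y| ≤ 1)
    (hK : ∀ s, K s = ρ.withDensity fun y => ENNReal.ofReal (1 + sgn s * b y)) :
    bias K =ᵐ[ρ] b := by
  have h := (posterior_ae_eq_of_withDensity K ρ hb hb1 hK).2
  filter_upwards [h 1, h (-1)] with y h1 h2
  rw [bias, h1, h2]
  have := abs_le.1 (hb1 y)
  simp only [sgn_one, sgn_neg_one]
  rw [show (1 + 1 * b y) / 2 - (1 + -1 * b y) / 2 = b y by ring, min_eq_right this.2,
    max_eq_right this.1]

theorem biasMean_of_withDensity (φ : ℝ → ℝ) (K : Kernel ℤˣ ζ) (ρ : Measure ζ) [IsFiniteMeasure ρ]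
    {b : ζ → ℝ} (hb : Measurable b) (hb1 : ∀ y, |b y| ≤ 1)
    (hK : ∀ s, K s = ρ.withDensity fun y => ENNReal.ofReal (1 + sgn s * b y)) :
    biasMean φ K = ∫ y, φ (b y) ∂ρ := by
  rw [biasMean, (posterior_ae_eq_of_withDensity K ρ hb hb1 hK).1]
  refine integral_congr_ae ?_
  filter_upwards [bias_ae_eq_of_withDensity K ρ hb hb1 hK] with y hy
  rw [hy]

theorem posterior_nonneg (K : Kernel ℤˣ ζ) (s : ℤˣ) (y : ζ) : 0 ≤ posterior K s y := by
  unfold posterior; positivity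

/-- The posterior probabilities of the two inputs are `(1 ± bias) / 2`. -/
theorem posterior_ae_eq (K : Kernel ℤˣ ζ) [IsMarkovKernel K] :
    ∀ᵐ y ∂outputLaw K, ∀ s, posterior K s y = (1 + sgn s * bias K y) / 2 := by
  have hsum : (fun y => (K 1).rnDeriv (outputLaw K) y + (K (-1)).rnDeriv (outputLaw K) y)
      =ᵐ[outputLaw K] fun _ => 2 := by
    refine ((Measure.rnDeriv_add _ _ _).symm.trans ?_)
    rw [← two_mul_outputLaw]
    refine (Measure.rnDeriv_smul_left_of_ne_top _ _ (by simp)).trans ?_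
    filter_upwards [Measure.rnDeriv_self (outputLaw K)] with y hy
    simp [hy]
  filter_upwards [hsum, Measure.rnDeriv_ne_top (K 1) (outputLaw K),
    Measure.rnDeriv_ne_top (K (-1)) (outputLaw K)] with y hy h1 h2
  have key : posterior K 1 y + posterior K (-1) y = 1 := by
    have := congrArg ENNReal.toReal hy
    rw [ENNReal.toReal_add h1 h2] at this
    simp only [ENNReal.toReal_ofNat] at this
    unfold posterior; linarith
  have p1 := posterior_nonneg K 1 y
  have p2 := posterior_nonneg K (-1) y
  have hb : bias K y = posterior K 1 y - posterior K (-1) y := by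
    rw [bias, min_eq_right (by linarith), max_eq_right (by linarith)]
  intro s
  rcases Int.units_eq_one_or s with rfl | rfl <;> simp only [hb, sgn_one, sgn_neg_one] <;> linarith

/-- The conditional laws of an experiment have densities `1 ± bias` with respect to the output
law. -/
theorem eq_withDensity_bias (K : Kernel ℤˣ ζ) [IsMarkovKernel K] (s : ℤˣ) :
    K s = (outputLaw K).withDensity fun y => ENNReal.ofReal (1 + sgn s * bias K y) := by
  rw [← Measure.withDensity_rnDeriv_eq _ _ (absolutelyContinuous_outputLaw K s)]
  refine withDensity_congr_ae ?_
  filter_upwards [posterior_ae_eq K, Measure.rnDeriv_ne_top (K s) (outputLaw K)] with y hy h1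
  rw [← ENNReal.ofReal_toReal h1]
  congr 1
  have := hy s
  unfold posterior at this
  linarith

theorem integral_kernel_eq (K : Kernel ℤˣ ζ) [IsMarkovKernel K] (s : ℤˣ) (f : ζ → ℝ) :
    ∫ y, f y ∂K s = ∫ y, (1 + sgn s * bias K y) * f y ∂outputLaw K := by
  have := measurable_bias K
  conv_lhs => rw [eq_withDensity_bias K s]
  rw [integral_withDensity_eq_integral_toReal_smul (by fun_prop) (by simp)]
  refine integral_congr_ae (.of_forall fun y => ?_)
  simp only [smul_eq_mul]
  rw [ENNReal.toReal_ofReal (one_add_sgn_mul_nonneg _ (abs_bias_le K y))]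

theorem integral_outputLaw (K : Kernel ℤˣ ζ) {f : ζ → ℝ} (h : ∀ s, Integrable f (K s)) :
    ∫ y, f y ∂outputLaw K = (∫ y, f y ∂K 1 + ∫ y, f y ∂K (-1)) / 2 := by
  rw [outputLaw, integral_smul_measure, integral_add_measure (h 1) (h (-1))]
  simp; ring

/-- The mean of the Bhattacharyya function of the bias is the Hellinger affinity of the two
conditional laws, whatever the dominating measure. -/
theorem biasMean_sqrt_of_withDensity (K : Kernel ℤˣ ζ) [IsMarkovKernel K] (ρ : Measure ζ)
    [IsFiniteMeasure ρ] {f : ℤˣ → ζ → ℝ} (hf : ∀ s, Measurable (f s)) (hf0 : ∀ s y, 0 ≤ f s y)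
    (hK : ∀ s, K s = ρ.withDensity fun y => ENNReal.ofReal (f s y)) :
    biasMean (fun x => √(1 - x ^ 2)) K = ∫ y, √(f 1 y * f (-1) y) ∂ρ := by
  have hf1 := hf 1
  have hf2 := hf (-1)
  set g : ζ → ℝ := fun y => (f 1 y + f (-1) y) / 2 with hg
  set b : ζ → ℝ := fun y => (f 1 y - f (-1) y) / (f 1 y + f (-1) y) with hb
  have hgm : Measurable g := by fun_prop
  have hbm : Measurable b := by fun_prop
  have hg0 : ∀ y, 0 ≤ g y := fun y => by
    have := hf0 1 y; have := hf0 (-1) y; simp only [hg]; positivity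
  have hb1 : ∀ y, |b y| ≤ 1 := fun y => by
    have h1 := hf0 1 y; have h2 := hf0 (-1) y
    rw [hb, abs_div, abs_of_nonneg (add_nonneg h1 h2)]
    refine div_le_one_of_le₀ ?_ (by positivity)
    rw [abs_le]; constructor <;> linarith
  have hfs : ∀ s y, f s y = g y * (1 + sgn s * b y) := fun s y => by
    have h1 := hf0 1 y; have h2 := hf0 (-1) y
    by_cases h : f 1 y + f (-1) y = 0
    · have e1 : f 1 y = 0 := by linarith
      have e2 : f (-1) y = 0 := by linarith
      rcases Int.units_eq_one_or s with rfl | rfl <;> simp [hg, e1, e2]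
    · rcases Int.units_eq_one_or s with rfl | rfl <;> simp only [hg, hb, sgn_one, sgn_neg_one] <;>
        field_simp <;> ring
  have hK' : ∀ s, K s = (ρ.withDensity fun y => ENNReal.ofReal (g y)).withDensity
      fun y => ENNReal.ofReal (1 + sgn s * b y) := fun s => by
    rw [hK s, ← withDensity_mul _ (by fun_prop) (by fun_prop)]
    congr 1; ext y
    rw [Pi.mul_apply, ← ENNReal.ofReal_mul (hg0 y), ← hfs]
  have hR : IsFiniteMeasure (ρ.withDensity fun y => ENNReal.ofReal (g y)) := by
    have h2 : ∫⁻ y, ENNReal.ofReal (g y) ∂ρ ≤ ∫⁻ y, ENNReal.ofReal (f 1 y) ∂ρ +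
        ∫⁻ y, ENNReal.ofReal (f (-1) y) ∂ρ := by
      rw [← lintegral_add_left (by fun_prop)]
      refine lintegral_mono fun y => ?_
      have h1 := hf0 1 y; have h2 := hf0 (-1) y
      rw [← ENNReal.ofReal_add h1 h2]
      exact ENNReal.ofReal_le_ofReal (by simp only [hg]; linarith)
    have h3 : ∀ s, ∫⁻ y, ENNReal.ofReal (f s y) ∂ρ = 1 := fun s => by
      rw [← setLIntegral_univ, ← withDensity_apply _ .univ, ← hK s, measure_univ]
    rw [h3, h3] at h2
    exact isFiniteMeasure_withDensity (ne_top_of_le_ne_top (by simp) h2)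
  rw [biasMean_of_withDensity _ K _ hbm hb1 hK',
    integral_withDensity_eq_integral_toReal_smul (by fun_prop) (by simp)]
  refine integral_congr_ae (.of_forall fun y => ?_)
  simp only [smul_eq_mul]
  rw [ENNReal.toReal_ofReal (hg0 y), hfs 1 y, hfs (-1) y, sgn_one, sgn_neg_one,
    show g y * (1 + 1 * b y) * (g y * (1 + -1 * b y)) = g y ^ 2 * (1 - b y ^ 2) by ring,
    Real.sqrt_mul (sq_nonneg _), Real.sqrt_sq (hg0 y)]

/-- The Bhattacharyya coefficient in terms of the bias. -/
theorem bhattacharyya_eq_biasMean (K : Kernel ℤˣ ζ) [IsMarkovKernel K] :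
    bhattacharyya K = biasMean (fun x => √(1 - x ^ 2)) K := by
  have h1 := measurable_posterior K 1
  have h2 := measurable_posterior K (-1)
  rw [bhattacharyya, deltaLaw, integral_map (by unfold deltaComponent; fun_prop) (by fun_prop),
    biasMean]
  refine integral_congr_ae ?_
  filter_upwards [posterior_ae_eq K] with y hy
  have hb := hy 1
  have hc := hy (-1)
  rw [sgn_one] at hb
  rw [sgn_neg_one] at hc
  have : deltaComponent K y * (1 - deltaComponent K y) = (1 - bias K y ^ 2) / 2 ^ 2 := by
    rw [deltaComponent, hb, hc]
    rcases min_choice ((1 + 1 * bias K y) / 2) ((1 + -1 * bias K y) / 2) with h | h <;>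
      rw [h] <;> ring
  rw [this, Real.sqrt_div' _ (by norm_num), Real.sqrt_sq (by norm_num)]
  ring

/-- An experiment whose bias vanishes almost everywhere has error probability `1/2`. -/
theorem probError_eq_half (K : Kernel ℤˣ ζ) [IsMarkovKernel K]
    (h : biasMean (fun x => x ^ 2) K = 0) : probError K = 1 / 2 := by
  have hm := measurable_bias K
  have h1 := measurable_posterior K 1
  have h2 := measurable_posterior K (-1)
  have hb : (fun y => bias K y ^ 2) =ᵐ[outputLaw K] 0 := by
    refine (integral_eq_zero_iff_of_nonneg (fun y => sq_nonneg _) ?_).1 h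
    refine Integrable.of_bound (hm.pow_const 2).aestronglyMeasurable 1 (.of_forall fun y => ?_)
    rw [Real.norm_eq_abs, abs_pow]
    exact pow_le_one₀ (abs_nonneg _) (abs_bias_le K y)
  rw [probError, deltaLaw, integral_map (by unfold deltaComponent; fun_prop) (by fun_prop)]
  have : deltaComponent K =ᵐ[outputLaw K] fun _ => 1 / 2 := by
    filter_upwards [hb, posterior_ae_eq K] with y hy hp
    have : bias K y = 0 := by simpa using hy
    rw [deltaComponent, hp, hp, this]; simp
  rw [integral_congr_ae this]; simp

end

/-! ### Degradation of experiments and conditional entropy -/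

noncomputable section

variable {ζ : Type*} [MeasurableSpace ζ]

theorem integrable_comp_bias {φ : ℝ → ℝ} (hφ : Continuous φ) (K : Kernel ℤˣ ζ) (μ : Measure ζ)
    [IsFiniteMeasure μ] : Integrable (fun y => φ (bias K y)) μ := by
  obtain ⟨c, hc⟩ := (isCompact_Icc (a := (-1 : ℝ)) (b := 1)).exists_bound_of_continuousOn
    hφ.continuousOn
  refine Integrable.of_bound (hφ.measurable.comp (measurable_bias K)).aestronglyMeasurable c
    (.of_forall fun y => hc _ (abs_le.1 (abs_bias_le K y)))

theorem integrable_bias (K : Kernel ℤˣ ζ) (μ : Measure ζ) [IsFiniteMeasure μ] :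
    Integrable (bias K) μ :=
  integrable_comp_bias continuous_id K μ

theorem biasMean_mono {φ ψ : ℝ → ℝ} (hφ : Continuous φ) (hψ : Continuous ψ)
    (h : ∀ x, |x| ≤ 1 → φ x ≤ ψ x) (K : Kernel ℤˣ ζ) [IsMarkovKernel K] :
    biasMean φ K ≤ biasMean ψ K :=
  integral_mono (integrable_comp_bias hφ K _) (integrable_comp_bias hψ K _)
    fun y => h _ (abs_bias_le K y)

theorem biasMean_const (c : ℝ) (K : Kernel ℤˣ ζ) [IsMarkovKernel K] :
    biasMean (fun _ => c) K = c := by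
  simp [biasMean]

theorem biasMean_sub {φ ψ : ℝ → ℝ} (hφ : Continuous φ) (hψ : Continuous ψ)
    (K : Kernel ℤˣ ζ) [IsMarkovKernel K] :
    biasMean (fun x => φ x - ψ x) K = biasMean φ K - biasMean ψ K :=
  integral_sub (integrable_comp_bias hφ K _) (integrable_comp_bias hψ K _)

theorem biasMean_const_mul (c : ℝ) (φ : ℝ → ℝ) (K : Kernel ℤˣ ζ) :
    biasMean (fun x => c * φ x) K = c * biasMean φ K :=
  integral_const_mul _ _

theorem outputLaw_map (K : Kernel ℤˣ ζ) {ξ : Type*} [MeasurableSpace ξ] {f : ζ → ξ}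
    (hf : Measurable f) : outputLaw (K.map f) = (outputLaw K).map f := by
  rw [outputLaw, outputLaw, Measure.map_smul, Measure.map_add _ _ hf, Kernel.map_apply _ hf,
    Kernel.map_apply _ hf]

theorem setIntegral_bias (K : Kernel ℤˣ ζ) [IsMarkovKernel K] (s : ℤˣ) {E : Set ζ}
    (hE : MeasurableSet E) :
    ∫ y in E, (1 + sgn s * bias K y) ∂outputLaw K = (K s).real E := by
  have h := integral_kernel_eq K s (E.indicator fun _ => 1)
  rw [integral_indicator_const _ hE] at h
  simp only [smul_eq_mul, mul_one] at h
  rw [h, ← integral_indicator hE]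
  congr 1; ext y
  by_cases hy : y ∈ E <;> simp [hy]

/-- The bias of a degraded experiment is the conditional expectation of the bias. -/
theorem bias_map_ae_eq_condExp (K : Kernel ℤˣ ζ) [IsMarkovKernel K] {ξ : Type*}
    [mξ : MeasurableSpace ξ] {f : ζ → ξ} (hf : Measurable f) :
    (fun y => bias (K.map f) (f y)) =ᵐ[outputLaw K] (outputLaw K)[bias K | mξ.comap f] := by
  have := Kernel.IsMarkovKernel.map K hf
  have hb := measurable_bias (K.map f)
  refine ae_eq_condExp_of_forall_setIntegral_eq hf.comap_le
    (integrable_bias K _) (fun E _ _ => ?_) ?_ ?_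
  · exact (Integrable.of_bound (hb.comp hf).aestronglyMeasurable 1
      (.of_forall fun y => abs_bias_le _ _)).integrableOn
  · rintro _ ⟨E, hE, rfl⟩ -
    have h1 := setIntegral_bias (K.map f) 1 hE
    have h2 := setIntegral_bias K 1 (hf hE)
    rw [outputLaw_map K hf, setIntegral_map hE (by fun_prop) hf.aemeasurable,
      Kernel.map_apply _ hf, measureReal_def, Measure.map_apply hf hE, ← measureReal_def, ← h2,
      integral_add (by fun_prop), integral_add (by fun_prop)] at h1
    · simpa using h1
    · exact ((integrable_bias K _).const_mul _).integrableOn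
    · exact ((Integrable.of_bound (hb.comp hf).aestronglyMeasurable 1
        (.of_forall fun y => abs_bias_le _ _)).const_mul _).integrableOn
  · exact (hb.comp (comap_measurable f)).aestronglyMeasurable

/-- Degrading an experiment decreases the mean of a convex function of the bias. -/
theorem biasMean_map_le (K : Kernel ℤˣ ζ) [IsMarkovKernel K] {ξ : Type*}
    [mξ : MeasurableSpace ξ] {f : ζ → ξ} (hf : Measurable f) {φ : ℝ → ℝ} (hφ : Continuous φ)
    (hc : ConvexOn ℝ (Set.Icc (-1) 1) φ) : biasMean φ (K.map f) ≤ biasMean φ K := by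
  have := Kernel.IsMarkovKernel.map K hf
  have hb := measurable_bias (K.map f)
  have h := hc.map_condExp_le (μ := outputLaw K) (f := bias K) hf.comap_le
    hφ.continuousOn.lowerSemicontinuousOn
    (.of_forall fun y => abs_le.1 (abs_bias_le K y)) isClosed_Icc
    (integrable_bias K _) (integrable_comp_bias hφ K _)
  rw [biasMean, outputLaw_map K hf,
    integral_map hf.aemeasurable (f := fun z => φ (bias (K.map f) z))
      (hφ.measurable.comp hb).aestronglyMeasurable]
  calc ∫ y, φ (bias (K.map f) (f y)) ∂outputLaw K
      ≤ ∫ y, ((outputLaw K)[φ ∘ bias K | mξ.comap f]) y ∂outputLaw K := by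
        refine integral_mono_ae ?_ integrable_condExp ?_
        · have := integrable_comp_bias hφ (K.map f) (outputLaw (K.map f))
          rw [outputLaw_map K hf] at this
          exact this.comp_measurable hf
        · filter_upwards [h, bias_map_ae_eq_condExp K hf] with y h1 h2
          rw [h2]; exact h1
    _ = biasMean φ K := integral_condExp hf.comap_le

/-- A relabelling of the outputs with a measurable left inverse does not change the bias. -/
theorem biasMean_map_of_leftInverse (K : Kernel ℤˣ ζ) [IsMarkovKernel K] {ξ : Type*}
    [mξ : MeasurableSpace ξ] {f : ζ → ξ} (hf : Measurable f) {g : ξ → ζ} (hg : Measurable g)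
    (h : Function.LeftInverse g f) (φ : ℝ → ℝ) (hφ : Continuous φ) :
    biasMean φ (K.map f) = biasMean φ K := by
  have hb := measurable_bias K
  rw [biasMean_of_withDensity φ (K.map f) ((outputLaw K).map f) (b := fun z => bias K (g z))
    (by fun_prop) (fun z => abs_bias_le _ _) fun s => ?_, integral_map hf.aemeasurable]
  · simp only [h _]; rfl
  · exact (hφ.measurable.comp (hb.comp hg)).aestronglyMeasurable
  · ext E hE
    rw [withDensity_apply _ hE, setLIntegral_map hE (by fun_prop) hf, Kernel.map_apply _ hf,
      Measure.map_apply hf hE]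
    conv_lhs => rw [eq_withDensity_bias K s]
    rw [withDensity_apply _ (hf hE)]
    simp only [h _]

/-- The conditional entropy of a uniform spin given the output of an experiment, as the mean of
a function of the bias. -/
theorem condEntropy_eq_biasMean {Ω : Type*} [MeasurableSpace Ω] (P : Measure Ω)
    [IsProbabilityMeasure P] {X : Ω → ℤˣ} (hX : Measurable X) {Z : Ω → ζ} (hZ : Measurable Z)
    (K : Kernel ℤˣ ζ) [IsMarkovKernel K]
    (h : ∀ s E, MeasurableSet E → P (X ⁻¹' {s} ∩ Z ⁻¹' E) = 2⁻¹ * K s E) :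
    condEntropy P X Z = biasMean (fun x => Real.binEntropy ((1 + x) / 2)) K := by
  have hb := measurable_bias K
  have hmap : P.map Z = outputLaw K := by
    ext E hE
    have hd : Z ⁻¹' E = (X ⁻¹' {1} ∩ Z ⁻¹' E) ∪ (X ⁻¹' {-1} ∩ Z ⁻¹' E) := by
      ext a; rcases Int.units_eq_one_or (X a) with h | h <;> simp [h]
    rw [Measure.map_apply hZ hE, hd, measure_union _ ((hX (.of_discrete)).inter (hZ hE)), h 1 E hE,
      h (-1) E hE, outputLaw, Measure.smul_apply, Measure.add_apply, smul_eq_mul, mul_add]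
    refine Set.disjoint_left.2 fun a ha ha' => ?_
    have h1 : X a = 1 := ha.1
    have h2 : X a = -1 := ha'.1
    rw [h1] at h2; exact absurd h2 (by decide)
  have hce : ∀ s, P⟦X ⁻¹' {s} | MeasurableSpace.comap Z inferInstance⟧ =ᵐ[P]
      fun a => (1 + sgn s * bias K (Z a)) / 2 := fun s => by
    symm
    have hi : Integrable (fun a => (1 + sgn s * bias K (Z a)) / 2) P := by
      have hm : Measurable fun a => (1 + sgn s * bias K (Z a)) / 2 :=
        (((hb.comp hZ).const_mul _).const_add _).div_const _
      refine Integrable.of_bound (C := 1) hm.aestronglyMeasurable (.of_forall fun a => ?_)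
      have h1 := one_add_sgn_mul_nonneg s (abs_bias_le K (Z a))
      rw [Real.norm_eq_abs, abs_of_nonneg (by positivity)]
      have : sgn s * bias K (Z a) ≤ 1 := (le_abs_self _).trans (by
        rw [abs_mul, abs_sgn, one_mul]; exact abs_bias_le _ _)
      linarith
    refine ae_eq_condExp_of_forall_setIntegral_eq hZ.comap_le ?_ (fun E _ _ => hi.integrableOn)
      ?_ ?_
    · exact (integrable_const (1 : ℝ)).indicator (hX .of_discrete)
    · rintro _ ⟨E, hE, rfl⟩ -
      rw [integral_indicator (hX .of_discrete), Measure.restrict_restrict (hX .of_discrete)]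
      simp only [integral_const, smul_eq_mul, mul_one, measureReal_restrict_apply_univ]
      rw [measureReal_def, h s E hE, ENNReal.toReal_mul, ← measureReal_def,
        ← setIntegral_bias K s hE,
        ← hmap, setIntegral_map hE (by fun_prop) hZ.aemeasurable, integral_div]
      simp; ring
    · refine Measurable.aestronglyMeasurable ?_
      have := hb.comp (comap_measurable Z)
      exact ((this.const_mul _).const_add _).div_const _
  have hh : ∀ᵐ a ∂P, ∑ x : ℤˣ,
      Real.negMulLog ((P⟦X ⁻¹' {x} | MeasurableSpace.comap Z inferInstance⟧) a)
      = Real.binEntropy ((1 + bias K (Z a)) / 2) := by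
    filter_upwards [hce 1, hce (-1)] with a h1 h2
    have : (Finset.univ : Finset ℤˣ) = {1, -1} := rfl
    rw [this, Finset.sum_pair (by decide), h1, h2,
      Real.binEntropy_eq_negMulLog_add_negMulLog_one_sub]
    simp only [sgn_one, sgn_neg_one]
    ring_nf
  rw [condEntropy, integral_congr_ae hh, biasMean, ← hmap, integral_map hZ.aemeasurable]
  have : Measurable fun x : ℝ => Real.binEntropy ((1 + x) / 2) :=
    Real.binEntropy_continuous.measurable.comp (by fun_prop)
  exact (this.comp hb).aestronglyMeasurable

/-- The mean of a function of the bias when part of the output is a variable `n ∈ ℕ` that does not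
depend on the input. -/
theorem biasMean_compProd {φ : ℝ → ℝ} (hφ : Continuous φ) (ν : Measure ℕ) [IsProbabilityMeasure ν]
    (κ : ℕ → Kernel ℤˣ ζ) [∀ n, IsMarkovKernel (κ n)] (K : Kernel ℤˣ (ℕ × ζ))
    (hK : ∀ s, K s = ν ⊗ₘ (Kernel.ofFunOfCountable fun n => κ n s)) :
    biasMean φ K = ∫ n, biasMean φ (κ n) ∂ν := by
  have : IsMarkovKernel (Kernel.ofFunOfCountable fun n => outputLaw (κ n)) :=
    ⟨fun n => inferInstanceAs (IsProbabilityMeasure (outputLaw (κ n)))⟩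
  have hk : ∀ s, IsMarkovKernel (Kernel.ofFunOfCountable fun n => κ n s) :=
    fun s => ⟨fun n => inferInstanceAs (IsProbabilityMeasure (κ n s))⟩
  have hb : Measurable fun p : ℕ × ζ => bias (κ p.1) p.2 :=
    measurable_from_prod_countable_right fun n => measurable_bias (κ n)
  rw [biasMean_of_withDensity φ K (ν ⊗ₘ Kernel.ofFunOfCountable fun n => outputLaw (κ n)) hb
    (fun p => abs_bias_le _ _) fun s => ?_, Measure.integral_compProd]
  · rfl
  · obtain ⟨c, hc⟩ := (isCompact_Icc (a := (-1 : ℝ)) (b := 1)).exists_bound_of_continuousOn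
      hφ.continuousOn
    exact Integrable.of_bound (hφ.measurable.comp hb).aestronglyMeasurable c
      (.of_forall fun y => hc _ (abs_le.1 (abs_bias_le _ _)))
  · ext E hE
    rw [hK s, withDensity_apply _ hE, Measure.compProd_apply hE, ← lintegral_indicator hE,
      Measure.lintegral_compProd ((by fun_prop : Measurable _).indicator hE)]
    refine lintegral_congr fun n => ?_
    have hn : MeasurableSet (Prod.mk n ⁻¹' E) := measurable_prodMk_left hE
    change (κ n s) (Prod.mk n ⁻¹' E) = _
    rw [eq_withDensity_bias (κ n) s, withDensity_apply _ hn, ← lintegral_indicator hn]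
    rfl

end

/-! ### Convexity on `[-1, 1]` -/

noncomputable section

theorem continuous_sqrt_one_sub (t : ℝ) : Continuous fun x : ℝ => √(1 - t * x ^ 2) := by fun_prop

theorem one_sub_mul_sq_pos {t x : ℝ} (ht : t ≤ 1) (hx : x ∈ Set.Ioo (-1 : ℝ) 1) :
    0 < 1 - t * x ^ 2 := by
  have h1 : x ^ 2 < 1 := by have := hx.1; have := hx.2; nlinarith
  nlinarith [sq_nonneg x]

theorem hasDerivAt_sqrt_one_sub {t x : ℝ} (h : 0 < 1 - t * x ^ 2) :
    HasDerivAt (fun x => √(1 - t * x ^ 2)) (-(t * x) / √(1 - t * x ^ 2)) x := by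
  have h1 : HasDerivAt (fun x : ℝ => 1 - t * x ^ 2) (-(t * (2 * x))) x := by
    simpa using ((hasDerivAt_pow 2 x).const_mul t).const_sub 1
  convert h1.sqrt h.ne' using 1
  field_simp

theorem hasDerivAt_deriv_sqrt_one_sub {t x : ℝ} (h : 0 < 1 - t * x ^ 2) :
    HasDerivAt (fun x => -(t * x) / √(1 - t * x ^ 2)) (-t / √(1 - t * x ^ 2) ^ 3) x := by
  have hs := Real.sqrt_pos.2 h
  have h1 : HasDerivAt (fun x : ℝ => -(t * x)) (-t) x :=
    ((hasDerivAt_id x).const_mul t).neg.congr_deriv (by simp)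
  refine (h1.div (hasDerivAt_sqrt_one_sub h) hs.ne').congr_deriv ?_
  have e : √(1 - t * x ^ 2) ^ 2 = 1 - t * x ^ 2 := Real.sq_sqrt h.le
  field_simp
  rw [e]; ring

theorem convexOn_neg_sqrt_one_sub {t : ℝ} (h0 : 0 ≤ t) (h1 : t ≤ 1) :
    ConvexOn ℝ (Set.Icc (-1) 1) fun x : ℝ => -√(1 - t * x ^ 2) := by
  refine convexOn_of_hasDerivWithinAt2_nonneg (convex_Icc _ _) (by fun_prop)
    (f' := fun x => -(-(t * x) / √(1 - t * x ^ 2))) (f'' := fun x => -(-t / √(1 - t * x ^ 2) ^ 3))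
    ?_ ?_ ?_ <;> rw [interior_Icc] <;> intro x hx
  · exact (hasDerivAt_sqrt_one_sub (one_sub_mul_sq_pos h1 hx)).neg.hasDerivWithinAt
  · exact (hasDerivAt_deriv_sqrt_one_sub (one_sub_mul_sq_pos h1 hx)).neg.hasDerivWithinAt
  · rw [neg_div, neg_neg]; positivity

/-- Compares the gaps of the means of `√(1 - t x²)` and `√(1 - x²)` under degradation: the former is
at most `t` times the latter. -/
theorem convexOn_sqrt_sub_mul_sqrt {t : ℝ} (h0 : 0 ≤ t) (h1 : t ≤ 1) :
    ConvexOn ℝ (Set.Icc (-1) 1) fun x : ℝ => √(1 - t * x ^ 2) - t * √(1 - x ^ 2) := by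
  have key : ConvexOn ℝ (Set.Icc (-1) 1)
      fun x : ℝ => √(1 - t * x ^ 2) - t * √(1 - 1 * x ^ 2) := by
    refine convexOn_of_hasDerivWithinAt2_nonneg (convex_Icc _ _) (by fun_prop)
      (f' := fun x => -(t * x) / √(1 - t * x ^ 2) - t * (-(1 * x) / √(1 - 1 * x ^ 2)))
      (f'' := fun x => -t / √(1 - t * x ^ 2) ^ 3 - t * (-1 / √(1 - 1 * x ^ 2) ^ 3))
      ?_ ?_ ?_ <;> rw [interior_Icc] <;> intro x hx <;>
      have p1 := one_sub_mul_sq_pos h1 hx <;> have p2 := one_sub_mul_sq_pos le_rfl hx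
    · exact ((hasDerivAt_sqrt_one_sub p1).sub
        ((hasDerivAt_sqrt_one_sub p2).const_mul t)).hasDerivWithinAt
    · exact ((hasDerivAt_deriv_sqrt_one_sub p1).sub
        ((hasDerivAt_deriv_sqrt_one_sub p2).const_mul t)).hasDerivWithinAt
    · have hs := Real.sqrt_pos.2 p2
      have hle : √(1 - 1 * x ^ 2) ≤ √(1 - t * x ^ 2) :=
        Real.sqrt_le_sqrt (by nlinarith [sq_nonneg x])
      have : 1 / √(1 - t * x ^ 2) ^ 3 ≤ 1 / √(1 - 1 * x ^ 2) ^ 3 := by gcongr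
      have := mul_le_mul_of_nonneg_left this h0
      rw [neg_div, neg_div, ← mul_one_div t]
      linarith
  simpa using key

/-- Bounds the loss of entropy under degradation by that of the Bhattacharyya coefficient: the
second derivatives of the two functions are `-(1 - x²)⁻¹` and `-(1 - x²)^(-3/2)`. -/
theorem convexOn_binEntropy_sub_sqrt :
    ConvexOn ℝ (Set.Icc (-1) 1) fun x : ℝ => Real.binEntropy ((1 + x) / 2) - √(1 - x ^ 2) := by
  have key : ConvexOn ℝ (Set.Icc (-1) 1)
      fun x : ℝ => Real.binEntropy ((1 + x) / 2) - √(1 - 1 * x ^ 2) := by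
    refine convexOn_of_hasDerivWithinAt2_nonneg (convex_Icc _ _)
      ((Real.binEntropy_continuous.comp (by fun_prop)).sub
        (continuous_sqrt_one_sub 1)).continuousOn
      (f' := fun x => (Real.log (1 - (1 + x) / 2) - Real.log ((1 + x) / 2)) * (1 / 2) -
        (-(1 * x) / √(1 - 1 * x ^ 2)))
      (f'' := fun x => -(1 / (1 - 1 * x ^ 2)) - (-1 / √(1 - 1 * x ^ 2) ^ 3))
      ?_ ?_ ?_ <;> rw [interior_Icc] <;> intro x hx <;>
      have p2 := one_sub_mul_sq_pos le_rfl hx <;>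
      have q1 : 0 < 1 + x := by linarith [hx.1]
    all_goals have q2 : 0 < 1 - x := by linarith [hx.2]
    all_goals have hl : HasDerivAt (fun x : ℝ => (1 + x) / 2) (1 / 2) x :=
      ((hasDerivAt_id x).const_add 1).div_const 2
    · refine (HasDerivAt.sub ?_ (hasDerivAt_sqrt_one_sub p2)).hasDerivWithinAt
      exact (Real.hasDerivAt_binEntropy (p := (1 + x) / 2) (by linarith) (by linarith)).comp x hl
    · refine (HasDerivAt.sub ?_ (hasDerivAt_deriv_sqrt_one_sub p2)).hasDerivWithinAt
      have r1 : (1 + x) / 2 ≠ 0 := by linarith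
      have r2 : 1 - (1 + x) / 2 ≠ 0 := by linarith
      refine ((((hl.const_sub 1).log r2).sub (hl.log r1)).mul_const (1 / 2)).congr_deriv ?_
      have : 1 - (1 + x) / 2 = (1 - x) / 2 := by ring
      rw [this]
      have : 1 - 1 * x ^ 2 = (1 - x) * (1 + x) := by ring
      rw [this]
      field_simp; ring
    · have hs := Real.sqrt_pos.2 p2
      have e : √(1 - 1 * x ^ 2) ^ 2 = 1 - 1 * x ^ 2 := Real.sq_sqrt p2.le
      have hs1 : √(1 - 1 * x ^ 2) ≤ 1 := Real.sqrt_le_one.2 (by nlinarith [sq_nonneg x])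
      have e' : 1 / (1 - 1 * x ^ 2) = 1 / √(1 - 1 * x ^ 2) ^ 2 := by rw [e]
      rw [neg_div, sub_neg_eq_add, e']
      have : 1 / √(1 - 1 * x ^ 2) ^ 2 ≤ 1 / √(1 - 1 * x ^ 2) ^ 3 :=
        one_div_le_one_div_of_le (by positivity) (pow_le_pow_of_le_one hs.le hs1 (by norm_num))
      linarith
  simpa using key

theorem convexOn_neg_binEntropy :
    ConvexOn ℝ (Set.Icc (-1) 1) fun x : ℝ => -Real.binEntropy ((1 + x) / 2) := by
  have h1 := Real.strictConcave_binEntropy.concaveOn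
  refine ⟨convex_Icc _ _, fun x hx y hy a b ha hb hab => ?_⟩
  have := h1.2 (x := (1 + x) / 2) (y := (1 + y) / 2) ⟨by linarith [hx.1], by linarith [hx.2]⟩
    ⟨by linarith [hy.1], by linarith [hy.2]⟩ ha hb hab
  simp only [smul_eq_mul] at this ⊢
  rw [show (1 + (a * x + b * y)) / 2 = a * ((1 + x) / 2) + b * ((1 + y) / 2) by
    rw [show b = 1 - a by linarith]; ring]
  linarith

/-! ### The offspring law -/

/-- The law of the number of children of a node. -/
def TreeModel.offspring : TreeModel → Measure ℕ
  | .regular d => Measure.dirac d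
  | .poissonGaltonWatson d => poissonMeasure d

instance (M : TreeModel) : IsProbabilityMeasure M.offspring := by
  cases M <;> (unfold TreeModel.offspring; infer_instance)

theorem TreeModel.law_eq (M : TreeModel) :
    M.law = Measure.infinitePi fun _ : List ℕ => M.offspring := by
  cases M
  · exact (Measure.infinitePi_dirac _).symm
  · rfl

/-- The mean number of siblings of a node: the ratio of the second factorial moment of the
offspring law to its mean.  It is `0` for the `0`-regular tree, which has no children. -/
def TreeModel.siblings : TreeModel → ℝ
  | .regular d => (d - 1 : ℕ)
  | .poissonGaltonWatson d => d

theorem TreeModel.degree_nonneg (M : TreeModel) : 0 ≤ M.degree := by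
  cases M <;> simp [degree]

theorem TreeModel.siblings_nonneg (M : TreeModel) : 0 ≤ M.siblings := by
  cases M <;> simp [siblings]

theorem TreeModel.siblings_pos (M : TreeModel) (h : 1 < M.degree) : 0 < M.siblings := by
  cases M with
  | regular d => simp only [degree, siblings, Nat.one_lt_cast, Nat.cast_pos] at *; omega
  | poissonGaltonWatson d => exact zero_lt_one.trans h

theorem hasSum_poisson_descFactorial (d : ℝ≥0) (j : ℕ) :
    HasSum (fun n : ℕ => Real.exp (-d) * d ^ n / n.factorial * (n.descFactorial j : ℝ))
      (d ^ j) := by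
  have h := (hasSum_one_poissonMeasure d).mul_left ((d : ℝ) ^ j)
  rw [mul_one] at h
  refine (hasSum_nat_add_iff' j).1 ?_
  rw [Finset.sum_eq_zero, sub_zero]
  · convert! h using 2 with n
    have h1 : ((n + j).factorial : ℝ) = n.factorial * (n + j).descFactorial j := by
      have := Nat.factorial_mul_descFactorial (Nat.le_add_left j n)
      rw [Nat.add_sub_cancel] at this
      exact_mod_cast this.symm
    have h2 : ((n + j).descFactorial j : ℝ) ≠ 0 :=
      Nat.cast_ne_zero.2 (Nat.descFactorial_eq_zero_iff_lt.not.2 (by omega))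
    have h3 : (n.factorial : ℝ) ≠ 0 := Nat.cast_ne_zero.2 n.factorial_ne_zero
    rw [h1, pow_add]
    field_simp
  · intro i hi
    rw [Nat.descFactorial_of_lt (Finset.mem_range.1 hi)]; simp

theorem hasSum_poisson_pow (d : ℝ≥0) (a : ℝ) :
    HasSum (fun n : ℕ => Real.exp (-d) * d ^ n / n.factorial * a ^ n)
      (Real.exp (-(d * (1 - a)))) := by
  have h := (NormedSpace.expSeries_div_hasSum_exp ((d : ℝ) * a)).mul_left (Real.exp (-d))
  rw [← Real.exp_eq_exp_ℝ, ← Real.exp_add] at h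
  convert! h using 1
  · ext n; rw [mul_pow]; ring
  · ring_nf

theorem TreeModel.integrable_descFactorial (M : TreeModel) (j : ℕ) :
    Integrable (fun n : ℕ => (n.descFactorial j : ℝ)) M.offspring := by
  cases M with
  | regular d => exact integrable_dirac (by simp)
  | poissonGaltonWatson d =>
    refine integrable_poissonMeasure_iff.2 ?_
    simpa using (hasSum_poisson_descFactorial d j).summable

theorem TreeModel.integral_descFactorial_one (M : TreeModel) :
    ∫ n : ℕ, (n : ℝ) ∂M.offspring = M.degree := by
  cases M with
  | regular d => simp [offspring, degree]
  | poissonGaltonWatson d =>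
    have h := (hasSum_poisson_descFactorial d 1).tsum_eq
    rw [offspring, integral_poissonMeasure, degree]
    simpa using h

theorem TreeModel.integral_descFactorial_two (M : TreeModel) :
    ∫ n : ℕ, (n : ℝ) * (n - 1) ∂M.offspring = M.degree * M.siblings := by
  cases M with
  | regular d => rcases d with _ | d <;> simp [offspring, degree, siblings]
  | poissonGaltonWatson d =>
    have h := (hasSum_poisson_descFactorial d 2).tsum_eq
    rw [offspring, integral_poissonMeasure, degree, siblings, ← sq, ← h]
    refine tsum_congr fun n => ?_
    rw [Nat.cast_descFactorial_two, smul_eq_mul]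

/-- The probability generating function of the offspring law. -/
def TreeModel.genFun (M : TreeModel) (a : ℝ) : ℝ := ∫ n : ℕ, a ^ n ∂M.offspring

/-- The secant slope of the generating function up to `a` is at most `d exp(-κ (1 - a))`, where `κ`
is the mean number of siblings.  This treats both tree models alike. -/
theorem TreeModel.genFun_sub_le (M : TreeModel) {a b : ℝ} (hb : 0 ≤ b) (hba : b ≤ a) :
    M.genFun a - M.genFun b ≤
      M.degree * Real.exp (-(M.siblings * (1 - a))) * (a - b) := by
  cases M with
  | regular d =>
    simp only [genFun, offspring, integral_dirac, degree, siblings]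
    have h1 : a ^ d - b ^ d ≤ d * a ^ (d - 1) * (a - b) := by
      rw [← Commute.geom_sum₂_mul (Commute.all a b)]
      refine mul_le_mul_of_nonneg_right ?_ (sub_nonneg.2 hba)
      have : ∀ i ∈ Finset.range d, a ^ i * b ^ (d - 1 - i) ≤ a ^ (d - 1) := fun i hi => by
        have hi' := Finset.mem_range.1 hi
        calc a ^ i * b ^ (d - 1 - i) ≤ a ^ i * a ^ (d - 1 - i) := by
              gcongr; exact pow_nonneg (hb.trans hba) _
          _ = a ^ (d - 1) := by rw [← pow_add]; congr 1; omega
      simpa using Finset.sum_le_card_nsmul _ _ _ this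
    have h2 : a ^ (d - 1) ≤ Real.exp (-(((d - 1 : ℕ) : ℝ) * (1 - a))) := by
      rw [show -(((d - 1 : ℕ) : ℝ) * (1 - a)) = ((d - 1 : ℕ) : ℝ) * (a - 1) by ring,
        Real.exp_nat_mul]
      refine pow_le_pow_left₀ (hb.trans hba) ?_ _
      have := Real.add_one_le_exp (a - 1); linarith
    refine h1.trans (mul_le_mul_of_nonneg_right ?_ (sub_nonneg.2 hba))
    gcongr
  | poissonGaltonWatson d =>
    have hG : ∀ a : ℝ, ∫ n : ℕ, a ^ n ∂poissonMeasure d = Real.exp (-(d * (1 - a))) := fun a => by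
      rw [integral_poissonMeasure, ← (hasSum_poisson_pow d a).tsum_eq]; rfl
    simp only [genFun, offspring, hG, degree, siblings]
    have : Real.exp (-(d * (1 - b))) = Real.exp (-(d * (1 - a))) * Real.exp (-(d * (a - b))) := by
      rw [← Real.exp_add]; ring_nf
    rw [this]
    have h1 := Real.add_one_le_exp (-(d * (a - b)))
    nlinarith [Real.exp_pos (-(d * (1 - a)))]

/-! ### The scalar recursion -/

theorem tendsto_zero_of_eventually_le_mul {D : ℕ → ℝ} (hD : ∀ k, 0 ≤ D k) {r : ℝ} (hr : r < 1)
    (h : ∀ᶠ k in atTop, D (k + 1) ≤ r * D k) : Tendsto D atTop (𝓝 0) := by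
  refine (summable_of_ratio_norm_eventually_le hr ?_).tendsto_atTop_zero
  filter_upwards [h] with k hk
  rwa [Real.norm_of_nonneg (hD _), Real.norm_of_nonneg (hD _)]

/-- The lower bound `u ↦ α u / (1 + u)` for the information recursion drives `u` above any level
below its fixed point `α - 1`: the inverse `1 / u` is contracted towards `1 / (α - 1)`. -/
theorem eventually_le_of_mobius_recursion {α : ℝ} (hα : 1 < α) {u : ℕ → ℝ} (hu0 : 0 < u 0)
    (hrec : ∀ k, α * u k / (1 + u k) ≤ u (k + 1)) {w : ℝ} (hw0 : 0 < w)
    (hw : w < α - 1) : ∀ᶠ k in atTop, w ≤ u k := by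
  have hα1 : 0 < α - 1 := by linarith
  have hpos : ∀ k, 0 < u k := fun k => by
    induction k with
    | zero => exact hu0
    | succ k ih => exact lt_of_lt_of_le (by positivity) (hrec k)
  have hinv : ∀ k, (u k)⁻¹ ≤ (α - 1)⁻¹ + α⁻¹ ^ k * (u 0)⁻¹ := fun k => by
    induction k with
    | zero => simp; linarith
    | succ k ih =>
      have h1 : (u (k + 1))⁻¹ ≤ (α * u k / (1 + u k))⁻¹ :=
        inv_anti₀ (by have := hpos k; positivity) (hrec k)
      have h2 : (α * u k / (1 + u k))⁻¹ = α⁻¹ * (u k)⁻¹ + α⁻¹ := by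
        have := (hpos k).ne'
        field_simp
      have h3 : (α - 1)⁻¹ = α⁻¹ * (α - 1)⁻¹ + α⁻¹ := by
        field_simp; ring
      calc (u (k + 1))⁻¹ ≤ α⁻¹ * (u k)⁻¹ + α⁻¹ := h1.trans h2.le
        _ ≤ α⁻¹ * ((α - 1)⁻¹ + α⁻¹ ^ k * (u 0)⁻¹) + α⁻¹ := by gcongr
        _ = (α⁻¹ * (α - 1)⁻¹ + α⁻¹) + α⁻¹ ^ (k + 1) * (u 0)⁻¹ := by ring
        _ = _ := by rw [← h3]
  have hlim : Tendsto (fun k : ℕ => (α - 1)⁻¹ + α⁻¹ ^ k * (u 0)⁻¹) atTop (𝓝 (α - 1)⁻¹) := by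
    simpa using ((tendsto_pow_atTop_nhds_zero_of_lt_one (by positivity)
      (inv_lt_one_of_one_lt₀ hα)).mul_const (u 0)⁻¹).const_add (α - 1)⁻¹
  filter_upwards [hlim.eventually_lt_const (inv_strictAnti₀ hw0 hw)] with k hk
  exact (inv_le_inv₀ (hpos k) hw0).1 ((hinv k).trans hk.le)

/-- The gap `D` tends to `0` if its contraction factor is governed by a quantity `u` that is driven
above any level below `α - 1`. -/
theorem tendsto_zero_of_recursion {α z : ℝ} (hα : 0 ≤ α) (hz : 0 ≤ z)
    (h : α * Real.exp (-(max (α - 1) 0) / 2) * z < 1) {u D : ℕ → ℝ}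
    (hu0 : 1 < α → 0 < u 0) (hu : ∀ k, 0 ≤ u k)
    (hrec : ∀ k, α * u k / (1 + u k) ≤ u (k + 1)) (hD : ∀ k, 0 ≤ D k)
    (hDrec : ∀ k, D (k + 1) ≤ z * α * Real.exp (-(u k / 2)) * D k) :
    Tendsto D atTop (𝓝 0) := by
  -- It suffices that the contraction factor is below `1` for `u k` above a level `w` which is
  -- eventually reached.
  obtain ⟨w, hw, hr⟩ : ∃ w, (∀ᶠ k in atTop, w ≤ u k) ∧ z * α * Real.exp (-(w / 2)) < 1 := by
    rcases le_or_gt α 1 with hα1 | hα1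
    · refine ⟨0, .of_forall hu, ?_⟩
      rw [max_eq_right (by linarith)] at h
      simp at h ⊢; linarith
    · rw [max_eq_left (by linarith)] at h
      have hc : Continuous fun w : ℝ => z * α * Real.exp (-(w / 2)) := by fun_prop
      have h' : z * α * Real.exp (-((α - 1) / 2)) < 1 := by
        rw [← neg_div]; linarith
      have h1 : ∀ᶠ w in 𝓝[<] (α - 1), z * α * Real.exp (-(w / 2)) < 1 :=
        (hc.continuousAt.eventually_lt_const h').filter_mono nhdsWithin_le_nhds
      have h2 : ∀ᶠ w in 𝓝[<] (α - 1), w ∈ Set.Ioo 0 (α - 1) :=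
        Ioo_mem_nhdsLT (by linarith)
      obtain ⟨w, hw1, hw2⟩ := (h1.and h2).exists
      exact ⟨w, eventually_le_of_mobius_recursion hα1 (hu0 hα1) hrec hw2.1 hw2.2, hw1⟩
  refine tendsto_zero_of_eventually_le_mul hD hr ?_
  filter_upwards [hw] with k hk
  refine (hDrec k).trans (mul_le_mul_of_nonneg_right ?_ (hD k))
  gcongr

end

/-! ### Products of experiments -/

noncomputable section

variable {ζ 𝒴 : Type*} [MeasurableSpace ζ] [MeasurableSpace 𝒴]

/-- Tilting finitely many factors of a product measure multiplies its density. -/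
theorem infinitePi_withDensity {ι : Type*} [DecidableEq ι] (ρ : ι → Measure ζ)
    [∀ i, IsProbabilityMeasure (ρ i)] {f : ι → ζ → ℝ≥0∞} (hf : ∀ i, Measurable (f i)) (s : Finset ι)
    (h1 : ∀ i, ∫⁻ x, f i x ∂ρ i = 1) :
    Measure.infinitePi (fun i => if i ∈ s then (ρ i).withDensity (f i) else ρ i) =
      (Measure.infinitePi ρ).withDensity fun z => ∏ i ∈ s, f i (z i) := by
  have (i : ι) : IsProbabilityMeasure (if i ∈ s then (ρ i).withDensity (f i) else ρ i) := by
    split_ifs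
    · exact ⟨by rw [withDensity_apply _ .univ, setLIntegral_univ, h1]⟩
    · infer_instance
  symm
  refine Measure.eq_infinitePi _ fun t A hA => ?_
  set h : ι → ζ → ℝ≥0∞ := fun i x =>
    (if i ∈ t then (A i).indicator 1 x else 1) * (if i ∈ s then f i x else 1) with hh
  have hm : ∀ i, Measurable (h i) := fun i => by
    refine Measurable.mul ?_ ?_
    · split_ifs
      · exact measurable_one.indicator (hA i)
      · fun_prop
    · split_ifs <;> fun_prop
  have hbox : MeasurableSet (Set.pi (t : Set ι) A) := .pi t.countable_toSet fun i _ => hA i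
  have hprod : ∀ z : ι → ζ, (Set.pi (t : Set ι) A).indicator (fun z => ∏ i ∈ s, f i (z i)) z =
      ∏ i ∈ t ∪ s, h i (z i) := fun z => by
    rw [hh, Finset.prod_mul_distrib]
    have e1 : ∏ i ∈ t ∪ s, (if i ∈ s then f i (z i) else 1) = ∏ i ∈ s, f i (z i) := by
      rw [Finset.prod_ite_mem]; congr 1; simp
    have e2 : ∏ i ∈ t ∪ s, (if i ∈ t then (A i).indicator (1 : ζ → ℝ≥0∞) (z i) else 1) =
        ∏ i ∈ t, (A i).indicator (1 : ζ → ℝ≥0∞) (z i) := by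
      rw [Finset.prod_ite_mem]; congr 1; simp
    rw [e1, e2]
    by_cases hz : z ∈ Set.pi (t : Set ι) A
    · rw [Set.indicator_of_mem hz, Finset.prod_eq_one fun i hi =>
        Set.indicator_of_mem (hz i hi) _, one_mul]
    · rw [Set.indicator_of_notMem hz]
      simp only [Set.mem_pi, not_forall] at hz
      obtain ⟨i, hi, hzi⟩ := hz
      rw [Finset.prod_eq_zero hi (Set.indicator_of_notMem hzi _), zero_mul]
  have hind : iIndepFun (fun i (z : ι → ζ) => h i (z i)) (Measure.infinitePi ρ) :=
    iIndepFun_infinitePi (P := ρ) hm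
  rw [withDensity_apply _ hbox, ← lintegral_indicator hbox, lintegral_congr hprod,
    lintegral_prod_eq_prod_lintegral_of_indepFun _ _ hind fun i =>
      (hm i).comp (measurable_pi_apply i)]
  have hint : ∀ i, ∫⁻ z, h i (z i) ∂Measure.infinitePi ρ = ∫⁻ x, h i x ∂ρ i := fun i => by
    rw [← lintegral_map (f := h i) (hm i) (measurable_pi_apply i), Measure.infinitePi_map_eval]
  simp only [hint]
  rw [← Finset.prod_subset (Finset.subset_union_left (s₂ := s)) (f := fun i => ∫⁻ x, h i x ∂ρ i)]
  · refine Finset.prod_congr rfl fun i hi => ?_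
    simp only [hh, hi, if_true]
    split_ifs with his
    · rw [withDensity_apply _ (hA i), ← lintegral_indicator (hA i)]
      refine lintegral_congr fun x => ?_
      by_cases hx : x ∈ A i <;> simp [hx]
    · simp [lintegral_indicator_one (hA i)]
  · intro i hi hit
    have his : i ∈ s := by simpa [hit] using hi
    simp [hh, hit, his, h1]

theorem integral_prod_infinitePi (ρ : ℕ → Measure ζ) [∀ i, IsProbabilityMeasure (ρ i)] {g : ζ → ℝ}
    (hg : Measurable g) (n : ℕ) :
    ∫ z, ∏ i ∈ Finset.range n, g (z i) ∂Measure.infinitePi ρ =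
      ∏ i ∈ Finset.range n, ∫ x, g x ∂ρ i := by
  have hind : iIndepFun (fun (i : Fin n) (z : ℕ → ζ) => z i) (Measure.infinitePi ρ) :=
    (iIndepFun_infinitePi (P := ρ) (X := fun _ x => x) fun _ => measurable_id).precomp
      Fin.val_injective
  simp only [Finset.prod_range]
  rw [hind.integral_fun_prod_comp (f := fun _ => g)
    (fun i => (measurable_pi_apply _).aemeasurable) fun i => hg.aestronglyMeasurable]
  refine Finset.prod_congr rfl fun i _ => ?_
  conv_rhs => rw [← Measure.infinitePi_map_eval ρ i]
  rw [integral_map (measurable_pi_apply _).aemeasurable hg.aestronglyMeasurable]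

theorem integral_bias_outputLaw (K : Kernel ℤˣ ζ) [IsMarkovKernel K] :
    ∫ y, bias K y ∂outputLaw K = 0 := by
  have h := setIntegral_bias K 1 .univ
  rw [setIntegral_univ, integral_add (integrable_const _)
    ((integrable_bias K _).const_mul _)] at h
  simpa using h

theorem integral_bias_kernel (K : Kernel ℤˣ ζ) [IsMarkovKernel K] (s : ℤˣ) :
    ∫ y, bias K y ∂K s = sgn s * biasMean (fun x => x ^ 2) K := by
  rw [integral_kernel_eq]
  have : ∀ y, (1 + sgn s * bias K y) * bias K y = bias K y + sgn s * bias K y ^ 2 :=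
    fun y => by ring
  simp only [this]
  rw [integral_add (integrable_bias K _)
    ((integrable_comp_bias (continuous_pow 2) K _).const_mul _), integral_bias_outputLaw,
    integral_const_mul, zero_add]
  rfl

/-- Variational lower bound for the second moment of the bias: any bounded statistic `Y` of the
output is at least as far in mean square from the input as the bias. -/
theorem le_biasMean_sq (K : Kernel ℤˣ ζ) [IsMarkovKernel K] {Y : ζ → ℝ} (hY : Measurable Y) {c : ℝ}
    (hc : ∀ y, |Y y| ≤ c) :
    (∫ y, Y y ∂K 1 - ∫ y, Y y ∂K (-1)) - (∫ y, Y y ^ 2 ∂K 1 + ∫ y, Y y ^ 2 ∂K (-1)) / 2 ≤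
      biasMean (fun x => x ^ 2) K := by
  have hb := measurable_bias K
  have hi : ∀ μ : Measure ζ, IsFiniteMeasure μ → Integrable Y μ := fun μ _ =>
    Integrable.of_bound hY.aestronglyMeasurable c (.of_forall hc)
  have hi2 : ∀ μ : Measure ζ, IsFiniteMeasure μ → Integrable (fun y => Y y ^ 2) μ := fun μ _ =>
    Integrable.of_bound (hY.pow_const 2).aestronglyMeasurable (c ^ 2) (.of_forall fun y => by
      rw [Real.norm_eq_abs, abs_pow]; gcongr; exact hc y)
  have hbi : Integrable (fun y => bias K y * Y y) (outputLaw K) :=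
    Integrable.of_bound (hb.mul hY).aestronglyMeasurable (1 * c) (.of_forall fun y => by
      rw [Real.norm_eq_abs, abs_mul]
      exact mul_le_mul (abs_bias_le K y) (hc y) (abs_nonneg _) zero_le_one)
  have h1 : ∀ s, ∫ y, Y y ∂K s = ∫ y, Y y ∂outputLaw K +
      sgn s * ∫ y, bias K y * Y y ∂outputLaw K := fun s => by
    rw [integral_kernel_eq, ← integral_const_mul, ← integral_add (hi _ inferInstance)
      (hbi.const_mul _)]
    congr 1; ext y; ring
  rw [← integral_outputLaw K fun s => hi2 _ inferInstance, h1, h1, sgn_one, sgn_neg_one]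
  have h2 : ∫ y, (2 * (bias K y * Y y) - Y y ^ 2) ∂outputLaw K ≤ biasMean (fun x => x ^ 2) K :=
    integral_mono ((hbi.const_mul 2).sub (hi2 _ inferInstance))
      (integrable_comp_bias (continuous_pow 2) K _) fun y => by
        have := sq_nonneg (bias K y - Y y)
        simp only
        linarith
  rw [integral_sub (hbi.const_mul 2) (hi2 _ inferInstance), integral_const_mul] at h2
  linarith

/-- The experiment that passes the input through a binary symmetric channel with flip probability
`δ` before applying `K`. -/
def noisy (δ : ℝ) (K : Kernel ℤˣ ζ) : Kernel ℤˣ ζ :=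
  Kernel.ofFunOfCountable fun s => ENNReal.ofReal (1 - δ) • K s + ENNReal.ofReal δ • K (-s)

theorem noisy_apply (δ : ℝ) (K : Kernel ℤˣ ζ) (s : ℤˣ) :
    noisy δ K s = ENNReal.ofReal (1 - δ) • K s + ENNReal.ofReal δ • K (-s) := rfl

theorem isMarkovKernel_noisy {δ : ℝ} (h0 : 0 ≤ δ) (h1 : δ ≤ 1) (K : Kernel ℤˣ ζ)
    [IsMarkovKernel K] : IsMarkovKernel (noisy δ K) := ⟨fun s => ⟨by
  simp [noisy_apply, ← ENNReal.ofReal_add (sub_nonneg.2 h1) h0]⟩⟩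

/-- Passing the input through a binary symmetric channel multiplies the bias by `1 - 2 δ`. -/
theorem noisy_eq_withDensity {δ : ℝ} (h0 : 0 ≤ δ) (h1 : δ ≤ 1) (K : Kernel ℤˣ ζ)
    [IsMarkovKernel K] (s : ℤˣ) :
    noisy δ K s = (outputLaw K).withDensity
      fun y => ENNReal.ofReal (1 + sgn s * ((1 - 2 * δ) * bias K y)) := by
  have hb := measurable_bias K
  rw [noisy_apply]
  conv_lhs => rw [eq_withDensity_bias K s, eq_withDensity_bias K (-s)]
  rw [← withDensity_smul _ (by fun_prop), ← withDensity_smul _ (by fun_prop),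
    ← withDensity_add_left (by fun_prop)]
  congr 1; ext y
  have e1 := one_add_sgn_mul_nonneg s (abs_bias_le K y)
  have e2 := one_add_sgn_mul_nonneg (-s) (abs_bias_le K y)
  have h1' := sub_nonneg.2 h1
  simp only [Pi.add_apply, Pi.smul_apply, smul_eq_mul]
  rw [← ENNReal.ofReal_mul h1', ← ENNReal.ofReal_mul h0,
    ← ENNReal.ofReal_add (mul_nonneg h1' e1) (mul_nonneg h0 e2), sgn_neg]
  congr 1; ring

theorem biasMean_noisy {δ : ℝ} (h0 : 0 ≤ δ) (h1 : δ ≤ 1) (K : Kernel ℤˣ ζ)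
    [IsMarkovKernel K] (φ : ℝ → ℝ) :
    biasMean φ (noisy δ K) = biasMean (fun x => φ ((1 - 2 * δ) * x)) K := by
  have hb := measurable_bias K
  refine biasMean_of_withDensity φ _ (outputLaw K) (b := fun y => (1 - 2 * δ) * bias K y)
    (by fun_prop) (fun y => ?_) (noisy_eq_withDensity h0 h1 K)
  rw [abs_mul]
  exact mul_le_one₀ (abs_le.2 ⟨by linarith, by linarith⟩) (abs_nonneg _) (abs_bias_le K y)

/-- The observation at a vertex with `n` children: the output of `W` at the vertex and the
independent outputs of `N` at the children, completed by independent variables of law `Λ`. -/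
def vertexKernel (W : Kernel ℤˣ 𝒴) (N : Kernel ℤˣ ζ) (Λ : Measure ζ) (n : ℕ) :
    Kernel ℤˣ (𝒴 × (ℕ → ζ)) :=
  Kernel.ofFunOfCountable fun s =>
    (W s).prod (Measure.infinitePi fun i => if i < n then N s else Λ)

theorem vertexKernel_apply (W : Kernel ℤˣ 𝒴) (N : Kernel ℤˣ ζ) (Λ : Measure ζ) (n : ℕ)
    (s : ℤˣ) : vertexKernel W N Λ n s =
    (W s).prod (Measure.infinitePi fun i => if i < n then N s else Λ) := rfl

section vertex

variable (W : Kernel ℤˣ 𝒴) [IsMarkovKernel W] (N : Kernel ℤˣ ζ) [IsMarkovKernel N]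
  (Λ : Measure ζ) [IsProbabilityMeasure Λ] (n : ℕ)

instance isProbabilityMeasure_ite (μ : Measure ζ) [IsProbabilityMeasure μ] (p : Prop)
    [Decidable p] : IsProbabilityMeasure (if p then μ else Λ) := by
  split_ifs <;> infer_instance

instance : IsMarkovKernel (vertexKernel W N Λ n) := ⟨fun s => by
  rw [vertexKernel_apply]; infer_instance⟩

theorem vertexKernel_eq_withDensity (s : ℤˣ) : vertexKernel W N Λ n s =
    ((outputLaw W).prod (Measure.infinitePi fun i => if i < n then outputLaw N else Λ)).withDensity
      fun p => ENNReal.ofReal ((1 + sgn s * bias W p.1) *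
        ∏ i ∈ Finset.range n, (1 + sgn s * bias N (p.2 i))) := by
  have hb := measurable_bias W
  have hn := measurable_bias N
  have h1 : ∫⁻ x, ENNReal.ofReal (1 + sgn s * bias N x) ∂outputLaw N = 1 := by
    rw [← setLIntegral_univ, ← withDensity_apply _ .univ, ← eq_withDensity_bias N s, measure_univ]
  have key : (Measure.infinitePi fun i => if i < n then N s else Λ) =
      (Measure.infinitePi fun i => if i < n then outputLaw N else Λ).withDensity
        fun z => ∏ i ∈ Finset.range n, ENNReal.ofReal (1 + sgn s * bias N (z i)) := by
    have h := infinitePi_withDensity (fun i => if i < n then outputLaw N else Λ)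
      (f := fun i x => if i < n then ENNReal.ofReal (1 + sgn s * bias N x) else 1)
      (fun i => by split_ifs <;> fun_prop) (Finset.range n) (fun i => by split_ifs <;> simp [h1])
    convert! h using 2
    · ext1 i
      by_cases hi : i < n
      · simp only [hi, Finset.mem_range, if_true]; exact eq_withDensity_bias N s
      · simp [hi]
    · ext1 z
      exact Finset.prod_congr rfl fun i hi => by simp [Finset.mem_range.1 hi]
  rw [vertexKernel_apply, key]
  conv_lhs => rw [eq_withDensity_bias W s]
  rw [prod_withDensity (by fun_prop) (by fun_prop)]
  congr 1; ext p
  rw [← ENNReal.ofReal_prod_of_nonneg fun i _ => one_add_sgn_mul_nonneg s (abs_bias_le N _),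
    ENNReal.ofReal_mul (one_add_sgn_mul_nonneg s (abs_bias_le W _))]

/-- The Bhattacharyya coefficient is multiplicative. -/
theorem biasMean_sqrt_vertexKernel :
    biasMean (fun x => √(1 - x ^ 2)) (vertexKernel W N Λ n) =
      biasMean (fun x => √(1 - x ^ 2)) W * biasMean (fun x => √(1 - x ^ 2)) N ^ n := by
  have hb := measurable_bias W
  have hn := measurable_bias N
  have hm : ∀ s, Measurable fun p : 𝒴 × (ℕ → ζ) => (1 + sgn s * bias W p.1) *
      ∏ i ∈ Finset.range n, (1 + sgn s * bias N (p.2 i)) := fun s => by fun_prop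
  have h0 : ∀ s (p : 𝒴 × (ℕ → ζ)), 0 ≤ (1 + sgn s * bias W p.1) *
      ∏ i ∈ Finset.range n, (1 + sgn s * bias N (p.2 i)) := fun s p =>
    mul_nonneg (one_add_sgn_mul_nonneg s (abs_bias_le W _))
      (Finset.prod_nonneg fun i _ => one_add_sgn_mul_nonneg s (abs_bias_le N _))
  have key := biasMean_sqrt_of_withDensity _ _ hm h0 (vertexKernel_eq_withDensity W N Λ n)
  have hsq : ∀ x : ℝ, |x| ≤ 1 → (1 + sgn 1 * x) * (1 + sgn (-1) * x) = √(1 - x ^ 2) ^ 2 :=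
    fun x hx => by
      rw [Real.sq_sqrt (sub_nonneg.2 ((sq_le_one_iff_abs_le_one x).2 hx)), sgn_one, sgn_neg_one]
      ring
  have hp : ∀ p : 𝒴 × (ℕ → ζ), √((1 + sgn 1 * bias W p.1) *
        (∏ i ∈ Finset.range n, (1 + sgn 1 * bias N (p.2 i))) * ((1 + sgn (-1) * bias W p.1) *
        ∏ i ∈ Finset.range n, (1 + sgn (-1) * bias N (p.2 i)))) =
      √(1 - bias W p.1 ^ 2) * ∏ i ∈ Finset.range n, √(1 - bias N (p.2 i) ^ 2) := fun p => by
    rw [mul_mul_mul_comm, ← Finset.prod_mul_distrib, hsq _ (abs_bias_le _ _),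
      Finset.prod_congr rfl fun i _ => hsq _ (abs_bias_le _ _), Finset.prod_pow, ← mul_pow,
      Real.sqrt_sq]
    exact mul_nonneg (Real.sqrt_nonneg _) (Finset.prod_nonneg fun i _ => Real.sqrt_nonneg _)
  rw [key, integral_congr_ae (.of_forall hp),
    integral_prod_mul (fun y => √(1 - bias W y ^ 2))
      (fun z : ℕ → ζ => ∏ i ∈ Finset.range n, √(1 - bias N (z i) ^ 2)),
    integral_prod_infinitePi _ (g := fun x => √(1 - bias N x ^ 2)) (by fun_prop),
    Finset.prod_congr rfl fun i hi => by rw [if_pos (Finset.mem_range.1 hi)]]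
  simp [biasMean]

theorem integral_vertexKernel_bias (s : ℤˣ) {i : ℕ} (hi : i < n) {φ : ℝ → ℝ} (hφ : Continuous φ) :
    ∫ p, φ (bias N (p.2 i)) ∂vertexKernel W N Λ n s = ∫ x, φ (bias N x) ∂N s := by
  have hn := measurable_bias N
  have hm : (vertexKernel W N Λ n s).map (fun p => p.2 i) = N s := by
    change (vertexKernel W N Λ n s).map ((fun z : ℕ → ζ => z i) ∘ Prod.snd) = N s
    rw [vertexKernel_apply, ← Measure.map_map (by fun_prop) measurable_snd, Measure.map_snd_prod,
      measure_univ, one_smul, Measure.infinitePi_map_eval, if_pos hi]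
  conv_rhs => rw [← hm]
  rw [integral_map (f := fun x => φ (bias N x)) (by fun_prop)
    (hφ.measurable.comp hn).aestronglyMeasurable]

theorem integral_vertexKernel_bias_mul (s : ℤˣ) {i j : ℕ} (hi : i < n) (hj : j < n) (hij : i ≠ j) :
    ∫ p, bias N (p.2 i) * bias N (p.2 j) ∂vertexKernel W N Λ n s = (∫ x, bias N x ∂N s) ^ 2 := by
  have hn := measurable_bias N
  have hm : (vertexKernel W N Λ n s).map (fun p => (p.2 i, p.2 j)) = (N s).prod (N s) := by
    change (vertexKernel W N Λ n s).map ((fun z : ℕ → ζ => (z i, z j)) ∘ Prod.snd) = _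
    rw [vertexKernel_apply, ← Measure.map_map (by fun_prop) measurable_snd, Measure.map_snd_prod,
      measure_univ, one_smul, Measure.infinitePi_map_eval_prod hij, if_pos hi, if_pos hj]
  rw [sq, ← integral_prod_mul, ← hm, integral_map (by fun_prop) (by fun_prop)]

/-- Lower bound for the second moment of the bias at a vertex, by a linear combination of the biases
of the children. -/
theorem le_biasMean_sq_vertexKernel (l : ℝ) :
    2 * l * n * biasMean (fun x => x ^ 2) N - l ^ 2 * (n * biasMean (fun x => x ^ 2) N +
      n * (n - 1) * biasMean (fun x => x ^ 2) N ^ 2) ≤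
      biasMean (fun x => x ^ 2) (vertexKernel W N Λ n) := by
  have hn := measurable_bias N
  set c := biasMean (fun x => x ^ 2) N with hc
  set Y : 𝒴 × (ℕ → ζ) → ℝ := fun p => l * ∑ i ∈ Finset.range n, bias N (p.2 i) with hY
  have hYm : Measurable Y := by fun_prop
  have hYb : ∀ p, |Y p| ≤ |l| * n := fun p => by
    rw [hY, abs_mul]
    refine mul_le_mul_of_nonneg_left ((Finset.abs_sum_le_sum_abs _ _).trans ?_) (abs_nonneg _)
    simpa using Finset.sum_le_card_nsmul (Finset.range n) _ 1 fun i _ => abs_bias_le N (p.2 i)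
  have hbi : ∀ s i, Integrable (fun p => bias N (p.2 i)) (vertexKernel W N Λ n s) := fun s i =>
    Integrable.of_bound (by fun_prop : Measurable fun p : 𝒴 × (ℕ → ζ) =>
      bias N (p.2 i)).aestronglyMeasurable 1 (.of_forall fun p => abs_bias_le N _)
  have hbij : ∀ s i j, Integrable (fun p => bias N (p.2 i) * bias N (p.2 j))
      (vertexKernel W N Λ n s) := fun s i j =>
    Integrable.of_bound (by fun_prop) 1 (.of_forall fun p => by
      rw [Real.norm_eq_abs, abs_mul]
      exact mul_le_one₀ (abs_bias_le N _) (abs_nonneg _) (abs_bias_le N _))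
  have h1 : ∀ s, ∫ p, Y p ∂vertexKernel W N Λ n s = l * (n * (sgn s * c)) := fun s => by
    rw [hY, integral_const_mul, integral_finsetSum _ fun i _ => hbi s i,
      Finset.sum_congr rfl fun i hi => (integral_vertexKernel_bias W N Λ n s
        (Finset.mem_range.1 hi) (φ := fun x => x) continuous_id).trans (integral_bias_kernel N s)]
    simp [hc]
  have h2 : ∀ s, ∫ p, Y p ^ 2 ∂vertexKernel W N Λ n s =
      l ^ 2 * (n * ∫ x, bias N x ^ 2 ∂N s + n * (n - 1) * c ^ 2) := fun s => by
    have e : ∀ p, Y p ^ 2 = l ^ 2 * ∑ i ∈ Finset.range n, ∑ j ∈ Finset.range n,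
        bias N (p.2 i) * bias N (p.2 j) := fun p => by
      rw [hY, mul_pow, sq (∑ i ∈ _, _), Finset.sum_mul_sum]
    simp only [e]
    rw [integral_const_mul, integral_finsetSum _ fun i _ => integrable_finsetSum _
      fun j _ => hbij s i j]
    congr 1
    have e2 : ∀ i ∈ Finset.range n, ∫ p, ∑ j ∈ Finset.range n,
        bias N (p.2 i) * bias N (p.2 j) ∂vertexKernel W N Λ n s =
        (∫ x, bias N x ^ 2 ∂N s) + (n - 1) * c ^ 2 := fun i hi => by
      rw [integral_finsetSum _ fun j _ => hbij s i j, ← Finset.add_sum_erase _ _ hi]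
      congr 1
      · simp only [← sq]
        exact integral_vertexKernel_bias W N Λ n s (Finset.mem_range.1 hi) (continuous_pow 2)
      · rw [Finset.sum_congr rfl fun j hj => integral_vertexKernel_bias_mul W N Λ n s
          (Finset.mem_range.1 hi) (Finset.mem_range.1 (Finset.mem_of_mem_erase hj))
          (Finset.ne_of_mem_erase hj).symm, integral_bias_kernel, Finset.sum_const,
          Finset.card_erase_of_mem hi, Finset.card_range, nsmul_eq_mul, mul_pow, sq (sgn s),
          sgn_mul_self, Nat.cast_pred (Nat.zero_lt_of_lt (Finset.mem_range.1 hi))]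
        ring
    rw [Finset.sum_congr rfl e2]
    simp; ring
  have h := le_biasMean_sq (vertexKernel W N Λ n) hYm hYb
  rw [h1, h1, h2, h2, sgn_one, sgn_neg_one] at h
  have h3 := integral_outputLaw N fun s => integrable_comp_bias (continuous_pow 2) N (N s)
  have h4 : c = (∫ x, bias N x ^ 2 ∂N 1 + ∫ x, bias N x ^ 2 ∂N (-1)) / 2 := h3
  refine le_trans (le_of_eq ?_) h
  linear_combination (-l ^ 2 * n) * h4

end vertex

end

/-! ### One generation of the recursion -/

noncomputable section

variable {ζ ξ 𝒴 : Type*} [MeasurableSpace ζ] [MeasurableSpace ξ] [MeasurableSpace 𝒴]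

/-- `IsStep M δ W K K'` says that `K'` is the experiment observing the root of a tree of the model
`M`, when `K` is the experiment observing a child of the root: up to a relabelling of the outputs,
`K'` shows the number `n` of children, the survey at the root and `n` conditionally independent
noisy copies of `K`, completed by variables that do not depend on the spins. -/
def IsStep (M : TreeModel) (δ : ℝ) (W : Kernel ℤˣ 𝒴) (K K' : Kernel ℤˣ ζ) : Prop :=
  ∃ (Λ : Measure ζ) (e : ℕ × 𝒴 × (ℕ → ζ) → ζ) (g : ζ → ℕ × 𝒴 × (ℕ → ζ)),
    IsProbabilityMeasure Λ ∧ Measurable e ∧ Measurable g ∧ Function.LeftInverse g e ∧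
      ∀ s, K' s = (M.offspring ⊗ₘ
        Kernel.ofFunOfCountable fun n => vertexKernel W (noisy δ K) Λ n s).map e

theorem IsStep.biasMean_eq {M : TreeModel} {δ : ℝ} (h0 : 0 ≤ δ) (h1 : δ ≤ 1)
    {W : Kernel ℤˣ 𝒴} [IsMarkovKernel W] {K K' : Kernel ℤˣ ζ} [IsMarkovKernel K]
    (h : IsStep M δ W K K') : ∃ Λ : Measure ζ, IsProbabilityMeasure Λ ∧ ∀ φ, Continuous φ →
      biasMean φ K' = ∫ n, biasMean φ (vertexKernel W (noisy δ K) Λ n) ∂M.offspring := by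
  obtain ⟨Λ, e, g, hΛ, he, hg, hge, hK⟩ := h
  have := isMarkovKernel_noisy h0 h1 K
  refine ⟨Λ, hΛ, fun φ hφ => ?_⟩
  have hk : ∀ s, IsMarkovKernel (Kernel.ofFunOfCountable fun n =>
      vertexKernel W (noisy δ K) Λ n s) := fun s =>
    ⟨fun n => inferInstanceAs (IsProbabilityMeasure (vertexKernel W (noisy δ K) Λ n s))⟩
  let J : Kernel ℤˣ (ℕ × 𝒴 × (ℕ → ζ)) := Kernel.ofFunOfCountable fun s => M.offspring ⊗ₘ
    Kernel.ofFunOfCountable fun n => vertexKernel W (noisy δ K) Λ n s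
  have hJ : IsMarkovKernel J := ⟨fun s => inferInstanceAs (IsProbabilityMeasure
    (M.offspring ⊗ₘ Kernel.ofFunOfCountable fun n => vertexKernel W (noisy δ K) Λ n s))⟩
  have hK' : K' = J.map e := by
    ext1 s
    rw [hK s, Kernel.map_apply _ he]; rfl
  rw [hK', biasMean_map_of_leftInverse J he hg hge φ hφ]
  exact biasMean_compProd hφ M.offspring _ J fun s => rfl

/-- The Bhattacharyya coefficients obey the recursion given by the generating function. -/
theorem IsStep.bhattacharyya_eq {M : TreeModel} {δ : ℝ} (h0 : 0 ≤ δ) (h1 : δ ≤ 1)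
    {W : Kernel ℤˣ 𝒴} [IsMarkovKernel W] {K K' : Kernel ℤˣ ζ} [IsMarkovKernel K]
    (h : IsStep M δ W K K') :
    biasMean (fun x => √(1 - x ^ 2)) K' = biasMean (fun x => √(1 - x ^ 2)) W *
      M.genFun (biasMean (fun x => √(1 - (1 - 2 * δ) ^ 2 * x ^ 2)) K) := by
  obtain ⟨Λ, hΛ, hφ⟩ := h.biasMean_eq h0 h1
  have := isMarkovKernel_noisy h0 h1 K
  rw [hφ _ (by fun_prop), TreeModel.genFun, ← integral_const_mul]
  refine integral_congr_ae (.of_forall fun n => ?_)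
  beta_reduce
  rw [biasMean_sqrt_vertexKernel, biasMean_noisy h0 h1]
  simp only [mul_pow]

/-- Lower bound for the growth of information from the leaves to the root. -/
theorem IsStep.le_biasMean_sq {M : TreeModel} {δ : ℝ} (h0 : 0 ≤ δ) (h1 : δ ≤ 1)
    {W : Kernel ℤˣ 𝒴} [IsMarkovKernel W] {K K' : Kernel ℤˣ ζ} [IsMarkovKernel K]
    (h : IsStep M δ W K K') :
    M.degree * ((1 - 2 * δ) ^ 2 * biasMean (fun x => x ^ 2) K) /
        (1 + M.siblings * ((1 - 2 * δ) ^ 2 * biasMean (fun x => x ^ 2) K)) ≤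
      biasMean (fun x => x ^ 2) K' := by
  obtain ⟨Λ, hΛ, hφ⟩ := h.biasMean_eq h0 h1
  have := isMarkovKernel_noisy h0 h1 K
  have hN : biasMean (fun x => x ^ 2) (noisy δ K) =
      (1 - 2 * δ) ^ 2 * biasMean (fun x => x ^ 2) K := by
    rw [biasMean_noisy h0 h1]
    simp only [mul_pow]
    exact biasMean_const_mul _ _ _
  have hκ := M.siblings_nonneg
  rw [hφ _ (by fun_prop), ← hN]
  set c := biasMean (fun x => x ^ 2) (noisy δ K) with hc
  have hc0 : 0 ≤ c := integral_nonneg fun y => sq_nonneg _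
  -- The optimal coefficient of the sum of the biases of the children.
  set l : ℝ := 1 / (1 + M.siblings * c) with hl
  have i1 : Integrable (fun n : ℕ => (n : ℝ)) M.offspring := by
    simpa using M.integrable_descFactorial 1
  have i2 : Integrable (fun n : ℕ => (n : ℝ) * (n - 1)) M.offspring := by
    simpa only [Nat.cast_descFactorial_two] using M.integrable_descFactorial 2
  have hle : ∫ n : ℕ, ((2 * l * c - l ^ 2 * c) * n - l ^ 2 * c ^ 2 * (n * (n - 1))) ∂M.offspring ≤
      ∫ n, biasMean (fun x => x ^ 2) (vertexKernel W (noisy δ K) Λ n) ∂M.offspring := by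
    refine integral_mono ((i1.const_mul _).sub (i2.const_mul _))
      (Integrable.of_bound (by fun_prop) 1 (.of_forall fun n => ?_)) fun n => ?_
    · have e0 : 0 ≤ biasMean (fun x => x ^ 2) (vertexKernel W (noisy δ K) Λ n) :=
        integral_nonneg fun y => sq_nonneg _
      rw [Real.norm_of_nonneg e0, ← biasMean_const 1 (vertexKernel W (noisy δ K) Λ n)]
      exact biasMean_mono (by fun_prop) (by fun_prop)
        (fun x hx => (sq_le_one_iff_abs_le_one x).2 hx) _
    · refine le_trans (le_of_eq ?_) (le_biasMean_sq_vertexKernel W (noisy δ K) Λ n l)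
      rw [← hc]; ring
  rw [integral_sub (i1.const_mul _) (i2.const_mul _), integral_const_mul, integral_const_mul,
    M.integral_descFactorial_one, M.integral_descFactorial_two] at hle
  refine le_trans (le_of_eq ?_) hle
  have : 1 + M.siblings * c ≠ 0 := by positivity
  rw [hl]; field_simp; ring

/-- Two sequences of experiments, one a degraded version of
the other, that obey the same recursion have asymptotically equal Bhattacharyya coefficients. -/
theorem tendsto_biasMean_sqrt_sub {M : TreeModel} {δ : ℝ} (h0 : 0 ≤ δ) (h1 : δ ≤ 1)
    {W : Kernel ℤˣ 𝒴} [IsMarkovKernel W] {K : ℕ → Kernel ℤˣ ζ} {L : ℕ → Kernel ℤˣ ξ}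
    [∀ k, IsMarkovKernel (K k)] [∀ k, IsMarkovKernel (L k)]
    (hK : ∀ k, IsStep M δ W (K k) (K (k + 1))) (hL : ∀ k, IsStep M δ W (L k) (L (k + 1)))
    {f : ξ → ζ} (hf : Measurable f) (hKL : ∀ k, K k = (L k).map f)
    (hK0 : 0 < biasMean (fun x => x ^ 2) (K 0))
    (h : M.degree * (1 - 2 * δ) ^ 2 * Real.exp (-(max (M.degree * (1 - 2 * δ) ^ 2 - 1) 0) / 2) *
      biasMean (fun x => √(1 - x ^ 2)) W < 1) :
    Tendsto (fun k => biasMean (fun x => √(1 - x ^ 2)) (K k) -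
      biasMean (fun x => √(1 - x ^ 2)) (L k)) atTop (𝓝 0) := by
  set t : ℝ := (1 - 2 * δ) ^ 2 with ht
  have ht0 : 0 ≤ t := sq_nonneg _
  have ht1 : t ≤ 1 := by rw [ht, sq_le_one_iff_abs_le_one, abs_le]; constructor <;> linarith
  set z := biasMean (fun x => √(1 - x ^ 2)) W with hz
  have hz0 : 0 ≤ z := integral_nonneg fun y => Real.sqrt_nonneg _
  set a : ℕ → ℝ := fun k => biasMean (fun x => √(1 - t * x ^ 2)) (K k) with ha
  set b : ℕ → ℝ := fun k => biasMean (fun x => √(1 - t * x ^ 2)) (L k) with hb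
  set C : ℕ → ℝ := fun k => biasMean (fun x => x ^ 2) (K k) with hC
  have hC0 : ∀ k, 0 ≤ C k := fun k => integral_nonneg fun y => sq_nonneg _
  have hd := M.degree_nonneg
  have hκ := M.siblings_nonneg
  -- Degradation decreases the mean of convex functions.
  have hneg : ∀ t : ℝ, 0 ≤ t → t ≤ 1 → ∀ k, biasMean (fun x => √(1 - t * x ^ 2)) (L k) ≤
      biasMean (fun x => √(1 - t * x ^ 2)) (K k) := fun t h0 h1 k => by
    have := biasMean_map_le (L k) hf (by fun_prop) (convexOn_neg_sqrt_one_sub h0 h1)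
    rw [← hKL] at this
    simp only [biasMean, integral_neg] at this ⊢
    linarith
  have hba : ∀ k, b k ≤ a k := hneg t ht0 ht1
  have hb0 : ∀ k, 0 ≤ b k := fun k => integral_nonneg fun y => Real.sqrt_nonneg _
  have hab : ∀ k, a k - b k ≤ t * (biasMean (fun x => √(1 - x ^ 2)) (K k) -
      biasMean (fun x => √(1 - x ^ 2)) (L k)) := fun k => by
    have := biasMean_map_le (L k) hf (by fun_prop) (convexOn_sqrt_sub_mul_sqrt ht0 ht1)
    rw [← hKL, biasMean_sub (by fun_prop) (by fun_prop), biasMean_sub (by fun_prop) (by fun_prop),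
      biasMean_const_mul, biasMean_const_mul] at this
    simp only [ha, hb]
    linarith
  have haC : ∀ k, t * C k / 2 ≤ 1 - a k := fun k => by
    have : a k ≤ biasMean (fun x => 1 - t / 2 * x ^ 2) (K k) :=
      biasMean_mono (by fun_prop) (by fun_prop) (fun x hx => by
        have hx2 := (sq_le_one_iff_abs_le_one x).2 hx
        have : 0 ≤ 1 - t * x ^ 2 := by nlinarith [sq_nonneg x]
        rw [Real.sqrt_le_left (by nlinarith [sq_nonneg x])]
        nlinarith [sq_nonneg (t * x ^ 2)]) _
    rw [biasMean_sub (by fun_prop) (by fun_prop), biasMean_const_mul, biasMean_const] at this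
    have : a k ≤ 1 - t / 2 * C k := this
    linarith
  refine tendsto_zero_of_recursion (α := M.degree * t) (z := z)
    (u := fun k => M.siblings * (t * C k))
    (by positivity) hz0 h (fun hα => ?_) (fun k => by have := hC0 k; positivity) (fun k => ?_)
    (fun k => ?_) fun k => ?_
  · have hd1 : 1 < M.degree := by nlinarith
    have := M.siblings_pos hd1
    have : 0 < t := by
      rcases ht0.eq_or_lt with h | h
      · rw [← h] at hα; norm_num at hα
      · exact h
    positivity
  · have h2 := (hK k).le_biasMean_sq h0 h1
    rw [← ht] at h2
    have h3 := mul_le_mul_of_nonneg_left h2 (mul_nonneg hκ ht0)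
    refine le_trans (le_of_eq ?_) (h3.trans (le_of_eq ?_))
    · simp only [hC]; ring
    · simp only [hC]; ring
  · have := hneg 1 zero_le_one le_rfl k
    simp only [one_mul] at this
    linarith
  · rw [(hK k).bhattacharyya_eq h0 h1, (hL k).bhattacharyya_eq h0 h1, ← mul_sub]
    change z * (M.genFun (a k) - M.genFun (b k)) ≤ _
    have h2 := M.genFun_sub_le (hb0 k) (hba k)
    have h3 : Real.exp (-(M.siblings * (1 - a k))) ≤ Real.exp (-(M.siblings * (t * C k) / 2)) := by
      have := mul_le_mul_of_nonneg_left (haC k) hκ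
      refine Real.exp_le_exp.2 ?_
      linarith
    have hD0 : 0 ≤ a k - b k := sub_nonneg.2 (hba k)
    calc z * (M.genFun (a k) - M.genFun (b k))
        ≤ z * (M.degree * Real.exp (-(M.siblings * (t * C k) / 2)) * (a k - b k)) := by
          refine mul_le_mul_of_nonneg_left (h2.trans ?_) hz0
          gcongr
      _ ≤ z * (M.degree * Real.exp (-(M.siblings * (t * C k) / 2)) *
          (t * (biasMean (fun x => √(1 - x ^ 2)) (K k) -
            biasMean (fun x => √(1 - x ^ 2)) (L k)))) := by
          gcongr; exact hab k
      _ = _ := by ring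

end

/-! ### Infinite product measures -/

noncomputable section

theorem infinitePi_prod {ι α β : Type*} [MeasurableSpace α] [MeasurableSpace β]
    (μ : ι → Measure α) (ν : ι → Measure β) [∀ i, IsProbabilityMeasure (μ i)]
    [∀ i, IsProbabilityMeasure (ν i)] :
    ((Measure.infinitePi μ).prod (Measure.infinitePi ν)).map (fun p i => (p.1 i, p.2 i)) =
      Measure.infinitePi fun i => (μ i).prod (ν i) := by
  refine IsProjectiveLimit.unique (fun I => ?_) (Measure.isProjectiveLimit_infinitePi _)
  have h :=
    (measurePreserving_arrowProdEquivProdArrow α β I (fun i => μ i) (fun i => ν i)).symm.map_eq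
  rw [← h, ← Measure.infinitePi_map_restrict, ← Measure.infinitePi_map_restrict,
    Measure.map_prod_map _ _ (by fun_prop) (by fun_prop),
    Measure.map_map (by fun_prop) (by fun_prop), Measure.map_map (by fun_prop) (by fun_prop)]
  rfl

/-- A coordinate of a product measure may be resampled. -/
theorem infinitePi_map_update {ι X : Type*} [DecidableEq ι] [MeasurableSpace X] (μ : ι → Measure X)
    [∀ i, IsProbabilityMeasure (μ i)] (o : ι) :
    ((μ o).prod (Measure.infinitePi μ)).map (fun p => Function.update p.2 o p.1) =
      Measure.infinitePi μ := by
  refine Measure.eq_infinitePi _ fun s t ht => ?_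
  have hm : Measurable fun p : X × (ι → X) => Function.update p.2 o p.1 := by
    refine measurable_pi_lambda _ fun i => ?_
    by_cases h : i = o
    · subst h; simpa using measurable_fst
    · simp only [Function.update_of_ne h]; fun_prop
  have hpre : (fun p : X × (ι → X) => Function.update p.2 o p.1) ⁻¹' Set.pi (s : Set ι) t =
      (if o ∈ s then t o else Set.univ) ×ˢ Set.pi ((s.erase o : Finset ι) : Set ι) t := by
    ext p
    simp only [Set.mem_preimage, Set.mem_pi, Finset.mem_coe, Set.mem_prod, Finset.mem_erase]
    constructor
    · intro h
      refine ⟨?_, fun i hi => by simpa [hi.1] using h i hi.2⟩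
      split_ifs with ho
      · simpa using h o ho
      · trivial
    · rintro ⟨h1, h2⟩ i hi
      by_cases hio : i = o
      · subst hio; simpa [hi] using h1
      · simpa [hio] using h2 i ⟨hio, hi⟩
  rw [Measure.map_apply hm (.pi s.countable_toSet fun i _ => ht i), hpre, Measure.prod_prod,
    Measure.infinitePi_pi _ fun i _ => ht i]
  split_ifs with ho
  · exact Finset.mul_prod_erase s (fun i => μ i (t i)) ho
  · rw [measure_univ, one_mul, Finset.erase_eq_of_notMem ho]

/-- Under a product measure, the coordinate at `o` is independent of the families of coordinates
`f i`, `i ∈ ℕ`, if these index sets are disjoint and do not contain `o`. -/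
theorem infinitePi_map_split {ι κ X : Type*} [MeasurableSpace X] (μ : ι → Measure X)
    [∀ i, IsProbabilityMeasure (μ i)] (o : ι) (f : ℕ → κ → ι)
    (hf : Function.Injective fun p : ℕ × κ => f p.1 p.2) (ho : ∀ i k, f i k ≠ o) :
    (Measure.infinitePi μ).map (fun x => (x o, fun i k => x (f i k))) =
      (μ o).prod (Measure.infinitePi fun i => Measure.infinitePi fun k => μ (f i k)) := by
  classical
  have h : (Measure.infinitePi μ).map (fun x => (x o, fun p : ℕ × κ => x (f p.1 p.2))) =
      (μ o).prod (Measure.infinitePi fun p : ℕ × κ => μ (f p.1 p.2)) := by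
    conv_lhs => rw [← infinitePi_map_update μ o]
    rw [Measure.map_map (by fun_prop) (by fun_prop),
      ← Measure.map_infinitePi_infinitePi_of_inj (P := μ) hf]
    conv_rhs => rw [← Measure.map_id (μ := μ o)]
    rw [Measure.map_prod_map _ _ measurable_id (by fun_prop)]
    congr 1; ext p : 1
    simp [ho, Prod.map]
  rw [← Measure.infinitePi_map_curry fun i k => μ (f i k)]
  conv_rhs => rw [← Measure.map_id (μ := μ o)]
  rw [Measure.map_prod_map _ _ measurable_id (by fun_prop), ← h,
    Measure.map_map (by fun_prop) (by fun_prop)]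
  rfl

theorem measurePreserving_prod_leftComm {α β γ : Type*} [MeasurableSpace α] [MeasurableSpace β]
    [MeasurableSpace γ] (μ : Measure α) (ν : Measure β) (ρ : Measure γ) [SigmaFinite μ]
    [SigmaFinite ν] [SigmaFinite ρ] :
    MeasurePreserving (fun p : α × β × γ => (p.2.1, p.1, p.2.2)) (μ.prod (ν.prod ρ))
      (ν.prod (μ.prod ρ)) :=
  (measurePreserving_prodAssoc ν μ ρ).comp
    ((Measure.measurePreserving_swap.prod (.id ρ)).comp
      ((measurePreserving_prodAssoc μ ν ρ).symm))

theorem prod_map_prodMk_eq_compProd {α β : Type*} [MeasurableSpace α] [MeasurableSpace β]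
    (ν : Measure ℕ) [IsProbabilityMeasure ν] (μ : Measure α) [IsProbabilityMeasure μ]
    {G : ℕ → α → β} (hG : ∀ n, Measurable (G n)) :
    (ν.prod μ).map (fun p => (p.1, G p.1 p.2)) =
      ν ⊗ₘ (Kernel.ofFunOfCountable fun n => μ.map (G n)) := by
  have hk : IsMarkovKernel (Kernel.ofFunOfCountable fun n => μ.map (G n)) :=
    ⟨fun n => Measure.isProbabilityMeasure_map (hG n).aemeasurable⟩
  have hm : Measurable fun p : ℕ × α => (p.1, G p.1 p.2) :=
    measurable_fst.prodMk (measurable_from_prod_countable_right hG)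
  ext E hE
  rw [Measure.map_apply hm hE, Measure.prod_apply (hm hE), Measure.compProd_apply hE]
  refine lintegral_congr fun n => ?_
  exact (Measure.map_apply (hG n) (measurable_prodMk_left hE)).symm

/-! ### The recursive structure of the sample space -/

variable {𝒴 ζ : Type*}

/-- The randomness of a sample other than the root spin. -/
abbrev Seed (𝒴 : Type*) : Type _ := Tree × (List ℕ → ℤˣ) × (List ℕ × ℤˣ → 𝒴)

/-- The sample with a given root spin and a given seed. -/
def mkSample (s : ℤˣ) (q : Seed 𝒴) : Sample 𝒴 := (q.1, s, q.2.1, q.2.2)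

/-- The seed of the subtree rooted at the `i`-th potential child of the root.  Its unused sign at
the root of the subtree is the sign of the edge to the root of the tree. -/
def subSeed (i : ℕ) (q : Seed 𝒴) : Seed 𝒴 :=
  (fun v => q.1 (v ++ [i]), fun v => q.2.1 (v ++ [i]), fun p => q.2.2 (p.1 ++ [i], p.2))

theorem spin_append (s : ℤˣ) (q : Seed 𝒴) (v : List ℕ) (i : ℕ) :
    spin (mkSample s q) (v ++ [i]) =
      spin (mkSample (s * (subSeed i q).2.1 []) (subSeed i q)) v := by
  induction v with
  | nil => rfl
  | cons j v ih => rw [List.cons_append, spin, ih]; rfl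

theorem survey_append (s : ℤˣ) (q : Seed 𝒴) (v : List ℕ) (i : ℕ) :
    survey (mkSample s q) (v ++ [i]) =
      survey (mkSample (s * (subSeed i q).2.1 []) (subSeed i q)) v := by
  rw [survey, spin_append]; rfl

theorem isNode_append (T : Tree) (v : List ℕ) (i : ℕ) :
    IsNode T (v ++ [i]) ↔ i < T [] ∧ IsNode (fun u => T (u ++ [i])) v := by
  induction v with
  | nil => simp [IsNode]
  | cons j v ih => rw [List.cons_append, IsNode, ih, IsNode]; tauto

theorem spin_update (s x : ℤˣ) (q : Seed 𝒴) (u : List ℕ) :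
    spin (mkSample s (q.1, Function.update q.2.1 [] x, q.2.2)) u = spin (mkSample s q) u := by
  induction u with
  | nil => rfl
  | cons i u ih => rw [spin, spin, ih]; congr 1

theorem survey_update (s x : ℤˣ) (q : Seed 𝒴) (u : List ℕ) :
    survey (mkSample s (q.1, Function.update q.2.1 [] x, q.2.2)) u = survey (mkSample s q) u := by
  rw [survey, spin_update]; rfl

variable [MeasurableSpace 𝒴] [MeasurableSpace ζ]

theorem measurable_mkSample (s : ℤˣ) : Measurable (mkSample s : Seed 𝒴 → Sample 𝒴) := by
  unfold mkSample; fun_prop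

theorem measurable_subSeed (i : ℕ) : Measurable (subSeed i : Seed 𝒴 → Seed 𝒴) := by
  unfold subSeed
  fun_prop

/-- The law of the seed. -/
def seedLaw (M : TreeModel) (δ : ℝ) (W : Kernel ℤˣ 𝒴) : Measure (Seed 𝒴) :=
  M.law.prod ((Measure.infinitePi fun _ : List ℕ => signLaw δ).prod
    (Measure.infinitePi fun p : List ℕ × ℤˣ => W p.2))

section seed

variable (M : TreeModel) {δ : ℝ} [IsProbabilityMeasure (signLaw δ)] (W : Kernel ℤˣ 𝒴)
  [IsMarkovKernel W]

instance : IsProbabilityMeasure (seedLaw M δ W) := by unfold seedLaw; infer_instance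

theorem append_singleton_injective :
    Function.Injective fun p : ℕ × List ℕ => p.2 ++ [p.1] := fun p q h => by
  have h' : p.2 ++ [p.1] = q.2 ++ [q.1] := h
  rw [List.append_singleton_inj] at h'
  exact Prod.ext h'.2 h'.1

/-- The number of children of the root, the survey at the root for a given root spin, and the seeds
of the subtrees at the potential children of the root are independent, and the latter have the law
of the original seed. -/
theorem seedLaw_map_split (s : ℤˣ) :
    (seedLaw M δ W).map (fun q => (q.1 [], q.2.2 ([], s), fun i => subSeed i q)) =
      M.offspring.prod ((W s).prod (Measure.infinitePi fun _ : ℕ => seedLaw M δ W)) := by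
  have hA := infinitePi_map_split (fun _ : List ℕ => M.offspring) [] (fun i v => v ++ [i])
    append_singleton_injective (by simp)
  have hB := infinitePi_map_split (fun _ : List ℕ => signLaw δ) [] (fun i v => v ++ [i])
    append_singleton_injective (by simp)
  have hC := infinitePi_map_split (fun p : List ℕ × ℤˣ => W p.2) ([], s)
    (fun i (p : List ℕ × ℤˣ) => (p.1 ++ [i], p.2)) (fun p q h => by
      have h1 := Prod.mk.inj h
      have h2 := append_singleton_injective (a₁ := (p.1, p.2.1)) (a₂ := (q.1, q.2.1)) h1.1
      simp only [Prod.mk.injEq] at h2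
      exact Prod.ext h2.1 (Prod.ext h2.2 h1.2)) (by simp)
  have pA : MeasurePreserving _ _ _ := ⟨by fun_prop, hA⟩
  have pB : MeasurePreserving _ _ _ := ⟨by fun_prop, hB⟩
  have pC : MeasurePreserving _ _ _ := ⟨by fun_prop, hC⟩
  have zBC : MeasurePreserving _ _ _ := ⟨by fun_prop, infinitePi_prod
    (fun _ : ℕ => Measure.infinitePi fun _ : List ℕ => signLaw δ)
    (fun _ : ℕ => Measure.infinitePi fun p : List ℕ × ℤˣ => W p.2)⟩
  have zA : MeasurePreserving _ _ _ := ⟨by fun_prop, infinitePi_prod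
    (fun _ : ℕ => Measure.infinitePi fun _ : List ℕ => M.offspring)
    (fun _ : ℕ => (Measure.infinitePi fun _ : List ℕ => signLaw δ).prod
      (Measure.infinitePi fun p : List ℕ × ℤˣ => W p.2))⟩
  have p1 := pA.prod ((measurePreserving_snd.comp pB).prod pC)
  have p2 := ((MeasurePreserving.id _).prod (((MeasurePreserving.id _).prod zBC).comp
    (measurePreserving_prod_leftComm _ _ _))).comp p1
  have p3 := ((MeasurePreserving.id _).prod (((MeasurePreserving.id _).prod zA).comp
    (measurePreserving_prod_leftComm _ _ _))).comp ((measurePreserving_prodAssoc _ _ _).comp p2)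
  simp only [seedLaw, M.law_eq]
  exact p3.map_eq

/-- The law of an observation given the root spin. -/
def obsKernel (δ : ℝ) (O : Sample 𝒴 → ζ) : Kernel ℤˣ ζ :=
  Kernel.ofFunOfCountable fun s => (seedLaw M δ W).map fun q => O (mkSample s q)

theorem isMarkovKernel_obsKernel {O : Sample 𝒴 → ζ} (hO : Measurable O) :
    IsMarkovKernel (obsKernel M W δ O) :=
  ⟨fun s => Measure.isProbabilityMeasure_map (hO.comp (measurable_mkSample s)).aemeasurable⟩

/-- The observation from a child of the root is a noisy observation of the root spin. -/
theorem seedLaw_map_noisy {O : Sample 𝒴 → ζ} (hO : Measurable O)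
    (hup : ∀ s x (q : Seed 𝒴),
      O (mkSample s (q.1, Function.update q.2.1 [] x, q.2.2)) = O (mkSample s q)) (s : ℤˣ) :
    (seedLaw M δ W).map (fun q => O (mkSample (s * q.2.1 []) q)) =
      noisy δ (obsKernel M W δ O) s := by
  have hres : MeasurePreserving
      (fun p : ℤˣ × Seed 𝒴 => ((p.2.1, Function.update p.2.2.1 [] p.1, p.2.2.2) : Seed 𝒴))
      ((signLaw δ).prod (seedLaw M δ W)) (seedLaw M δ W) := by
    have hu : MeasurePreserving
        (fun p : ℤˣ × (List ℕ → ℤˣ) => Function.update p.2 ([] : List ℕ) p.1)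
        ((signLaw δ).prod (Measure.infinitePi fun _ : List ℕ => signLaw δ))
        (Measure.infinitePi fun _ : List ℕ => signLaw δ) :=
      ⟨by fun_prop, infinitePi_map_update (fun _ : List ℕ => signLaw δ) []⟩
    exact ((MeasurePreserving.id M.law).prod ((hu.prod (.id _)).comp
      (measurePreserving_prodAssoc _ _ _).symm)).comp (measurePreserving_prod_leftComm _ _ _)
  have hm : ∀ s, Measurable fun q : Seed 𝒴 => O (mkSample s q) := fun s =>
    hO.comp (measurable_mkSample s)
  have hm1 : Measurable fun p : ℤˣ × Seed 𝒴 => O (mkSample (s * p.1) p.2) :=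
    measurable_from_prod_countable_right fun x => hm (s * x)
  have hm2 : Measurable fun q : Seed 𝒴 => O (mkSample (s * q.2.1 []) q) :=
    hm1.comp (f := fun q : Seed 𝒴 => (q.2.1 [], q)) (by fun_prop)
  conv_lhs => rw [← hres.map_eq]
  rw [Measure.map_map hm2 hres.measurable]
  have hfun : (fun q : Seed 𝒴 => O (mkSample (s * q.2.1 []) q)) ∘
      (fun p : ℤˣ × Seed 𝒴 => ((p.2.1, Function.update p.2.2.1 [] p.1, p.2.2.2) : Seed 𝒴)) =
      fun p => O (mkSample (s * p.1) p.2) := by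
    ext1 p
    simp only [Function.comp_apply, Function.update_self]
    exact hup _ _ p.2
  rw [hfun]
  ext E hE
  rw [Measure.map_apply hm1 hE, Measure.prod_apply (hm1 hE), signLaw, lintegral_add_measure,
    lintegral_smul_measure, lintegral_smul_measure, lintegral_dirac, lintegral_dirac, noisy_apply,
    add_comm, Measure.add_apply, Measure.smul_apply, Measure.smul_apply]
  have hk : ∀ s, obsKernel M W δ O s E = seedLaw M δ W {q | O (mkSample s q) ∈ E} := fun s =>
    Measure.map_apply (hm s) hE
  rw [hk, hk]
  simp only [Set.preimage, Set.mem_ofPred_eq, mul_one, mul_neg]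

/-- Observations of the root spin that are assembled invertibly, by `e`, from the number of
children, the survey at the root and the previous observations from the children obey the
recursion.  For the potential children that do not exist, `r` records the tree only. -/
theorem isStep_obsKernel {O O' : Sample 𝒴 → ζ} (hO : Measurable O)
    (hup : ∀ s x (q : Seed 𝒴),
      O (mkSample s (q.1, Function.update q.2.1 [] x, q.2.2)) = O (mkSample s q))
    {r : Tree → ζ} (hr : Measurable r) {e : ℕ × 𝒴 × (ℕ → ζ) → ζ} (he : Measurable e)
    {g : ζ → ℕ × 𝒴 × (ℕ → ζ)} (hg : Measurable g) (hge : Function.LeftInverse g e)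
    (h : ∀ s (q : Seed 𝒴), O' (mkSample s q) = e (q.1 [], q.2.2 ([], s), fun i =>
      if i < q.1 [] then O (mkSample (s * (subSeed i q).2.1 []) (subSeed i q))
      else r (subSeed i q).1)) :
    IsStep M δ W (obsKernel M W δ O) (obsKernel M W δ O') := by
  refine ⟨M.law.map r, e, g, Measure.isProbabilityMeasure_map hr.aemeasurable, he, hg, hge,
    fun s => ?_⟩
  have hm : ∀ s, Measurable fun q : Seed 𝒴 => O (mkSample s q) := fun s =>
    hO.comp (measurable_mkSample s)
  have hm1 : Measurable fun p : ℤˣ × Seed 𝒴 => O (mkSample (s * p.1) p.2) :=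
    measurable_from_prod_countable_right fun x => hm (s * x)
  have hm2 : Measurable fun q : Seed 𝒴 => O (mkSample (s * q.2.1 []) q) :=
    hm1.comp (f := fun q : Seed 𝒴 => (q.2.1 [], q)) (by fun_prop)
  have hr' : Measurable fun q : Seed 𝒴 => r q.1 := hr.comp measurable_fst
  -- The observation of the `i`-th subtree, when the root has `n` children.
  set F : ℕ → ℕ → Seed 𝒴 → ζ := fun n i q =>
    if i < n then O (mkSample (s * q.2.1 []) q) else r q.1 with hF
  have hFm : ∀ n i, Measurable (F n i) := fun n i => by
    simp only [hF]; split_ifs <;> assumption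
  set G : ℕ → 𝒴 × (ℕ → Seed 𝒴) → 𝒴 × (ℕ → ζ) := fun n p => (p.1, fun i => F n i (p.2 i)) with hG
  have hGm : ∀ n, Measurable (G n) := fun n => by fun_prop
  have hsplit : Measurable fun q : Seed 𝒴 => (q.1 [], q.2.2 ([], s), fun i => subSeed i q) := by
    have := measurable_subSeed (𝒴 := 𝒴)
    fun_prop
  have hpair : Measurable fun p : ℕ × 𝒴 × (ℕ → Seed 𝒴) => (p.1, G p.1 p.2) :=
    measurable_fst.prodMk (measurable_from_prod_countable_right hGm)
  have hfun : (fun q => O' (mkSample s q)) = e ∘ (fun p => (p.1, G p.1 p.2)) ∘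
      fun q : Seed 𝒴 => (q.1 [], q.2.2 ([], s), fun i => subSeed i q) := by
    ext1 q; exact h s q
  change (seedLaw M δ W).map (fun q => O' (mkSample s q)) = _
  rw [hfun, ← Measure.map_map he (hpair.comp hsplit), ← Measure.map_map hpair hsplit,
    seedLaw_map_split, prod_map_prodMk_eq_compProd _ _ hGm]
  congr 3
  ext1 n
  have hFn : ∀ i, (seedLaw M δ W).map (F n i) =
      if i < n then noisy δ (obsKernel M W δ O) s else M.law.map r := fun i => by
    simp only [hF]
    split_ifs
    · exact seedLaw_map_noisy M W hO hup s
    · change (seedLaw M δ W).map (r ∘ Prod.fst) = _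
      rw [← Measure.map_map hr measurable_fst, seedLaw, Measure.map_fst_prod,
        measure_univ, one_smul]
  have := Measure.isProbabilityMeasure_map (μ := M.law) hr.aemeasurable
  rw [vertexKernel_apply]
  have hinf := Measure.infinitePi_map_pi (fun _ : ℕ => seedLaw M δ W) (hFm n)
  simp only [hFn] at hinf
  rw [← hinf]
  conv_rhs => rw [← Measure.map_id (μ := W s)]
  rw [Measure.map_prod_map _ _ measurable_id (by fun_prop)]
  rfl

/-- The joint law of the root spin and the seed. -/
theorem botsMeasure_apply {A : Set (Sample 𝒴)} (hA : MeasurableSet A) :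
    botsMeasure M δ W A = 2⁻¹ * (seedLaw M δ W (mkSample 1 ⁻¹' A) +
      seedLaw M δ W (mkSample (-1) ⁻¹' A)) := by
  have := isProbabilityMeasure_signLaw (δ := 1 / 2) (by norm_num) (by norm_num)
  have hp : MeasurePreserving (fun p : ℤˣ × Seed 𝒴 => mkSample p.1 p.2)
      ((signLaw (1 / 2)).prod (seedLaw M δ W)) (botsMeasure M δ W) :=
    measurePreserving_prod_leftComm _ _ _
  rw [← hp.measure_preimage hA.nullMeasurableSet, Measure.prod_apply (hp.measurable hA), signLaw,
    lintegral_add_measure, lintegral_smul_measure, lintegral_smul_measure, lintegral_dirac,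
    lintegral_dirac, add_comm, mul_add, sub_half,
    show ENNReal.ofReal (1 / 2) = 2⁻¹ by rw [one_div, ENNReal.ofReal_inv_of_pos two_pos]; simp]
  rfl

end seed

end

/-! ### The observations on the tree obey the recursion -/

noncomputable section

variable {𝒴 E : Type*}

/-- The family indexed by the nodes with a given value at the root and given values on the subtrees
at the children of the root. -/
def glue (x : E) (z : ℕ → List ℕ → E) (u : List ℕ) : E :=
  if h : u = [] then x else z (u.getLast h) u.dropLast

@[simp] theorem glue_nil (x : E) (z : ℕ → List ℕ → E) : glue x z [] = x := by simp [glue]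

@[simp] theorem glue_append (x : E) (z : ℕ → List ℕ → E) (v : List ℕ) (i : ℕ) :
    glue x z (v ++ [i]) = z i v := by simp [glue]

/-- Every family indexed by the nodes is glued from its values at the root and on the subtrees. -/
theorem eq_glue {x : E} {z : ℕ → List ℕ → E} {y : List ℕ → E} (h0 : y [] = x)
    (h : ∀ i v, y (v ++ [i]) = z i v) : y = glue x z := by
  ext1 u
  rcases List.eq_nil_or_concat u with rfl | ⟨v, i, rfl⟩
  · simp [h0]
  · simp [h]

theorem measurable_glue {α : Type*} [MeasurableSpace α] [MeasurableSpace E] {x : α → E}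
    (hx : Measurable x) {z : α → ℕ → List ℕ → E} (hz : ∀ i v, Measurable fun a => z a i v) :
    Measurable fun a => glue (x a) (z a) := by
  refine measurable_pi_lambda _ fun u => ?_
  rcases List.eq_nil_or_concat u with rfl | ⟨v, i, rfl⟩
  · simpa using hx
  · simpa using hz i v

theorem restrictTo_of_mem {S : Set (List ℕ)} {u : List ℕ} (h : u ∈ S) (x : List ℕ → E) :
    restrictTo S x u = Sum.inr (x u) := if_pos h

theorem restrictTo_of_notMem {S : Set (List ℕ)} {u : List ℕ} (h : u ∉ S) (x : List ℕ → E) :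
    restrictTo S x u = Sum.inl () := if_neg h

/-- A set of nodes whose trace on the subtree at the child `i` of the root is `S' i` if `i < n`, and
empty otherwise: the restriction to it is computed subtree by subtree. -/
theorem restrictTo_append {S : Set (List ℕ)} {n : ℕ} {S' : ℕ → Set (List ℕ)}
    (h : ∀ i v, v ++ [i] ∈ S ↔ i < n ∧ v ∈ S' i) (x : List ℕ → E) (i : ℕ) (v : List ℕ) :
    restrictTo S x (v ++ [i]) = (if i < n then restrictTo (S' i) fun v => x (v ++ [i])
      else fun _ => Sum.inl ()) v := by
  by_cases hi : i < n
  · rw [if_pos hi]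
    by_cases hv : v ∈ S' i
    · rw [restrictTo_of_mem ((h i v).2 ⟨hi, hv⟩), restrictTo_of_mem hv]
    · rw [restrictTo_of_notMem fun h' => hv ((h i v).1 h').2, restrictTo_of_notMem hv]
  · rw [if_neg hi, restrictTo_of_notMem fun h' => hi ((h i v).1 h').1]

theorem nil_mem_truncation (T : Tree) (k : ℕ) : [] ∈ truncation T k :=
  (⟨trivial, Nat.zero_le _⟩ : IsNode T [] ∧ _)

theorem restrictTo_truncation_succ (T : Tree) (k : ℕ) (x : List ℕ → E) :
    restrictTo (truncation T (k + 1)) x = glue (Sum.inr (x [])) fun i =>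
      if i < T [] then restrictTo (truncation (fun v => T (v ++ [i])) k) fun v => x (v ++ [i])
      else fun _ => Sum.inl () :=
  eq_glue (restrictTo_of_mem (nil_mem_truncation _ _) x)
    (restrictTo_append (S' := fun i => truncation (fun v => T (v ++ [i])) k) (fun i v => by
      change IsNode T (v ++ [i]) ∧ (v ++ [i]).length ≤ k + 1 ↔
        i < T [] ∧ IsNode (fun v => T (v ++ [i])) v ∧ v.length ≤ k
      rw [isNode_append, List.length_append, List.length_singleton, Nat.add_le_add_iff_right,
        and_assoc]) x)

theorem restrictTo_levelSet_succ (T : Tree) (k : ℕ) (x : List ℕ → E) :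
    restrictTo (levelSet T (k + 1)) x = glue (Sum.inl ()) fun i =>
      if i < T [] then restrictTo (levelSet (fun v => T (v ++ [i])) k) fun v => x (v ++ [i])
      else fun _ => Sum.inl () :=
  eq_glue (restrictTo_of_notMem (fun h => Nat.succ_ne_zero k h.2.symm) x)
    (restrictTo_append (S' := fun i => levelSet (fun v => T (v ++ [i])) k) (fun i v => by
      change IsNode T (v ++ [i]) ∧ (v ++ [i]).length = k + 1 ↔
        i < T [] ∧ IsNode (fun v => T (v ++ [i])) v ∧ v.length = k
      rw [isNode_append, List.length_append, List.length_singleton, Nat.add_right_cancel_iff,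
        and_assoc]) x)

/-- The tree and its survey, from the number of children of the root, the survey at the root, and
the subtrees with their surveys. -/
def joinSurvey (p : ℕ × 𝒴 × (ℕ → Tree × (List ℕ → Unit ⊕ 𝒴))) : Tree × (List ℕ → Unit ⊕ 𝒴) :=
  (glue p.1 fun i => (p.2.2 i).1, glue (Sum.inr p.2.1) fun i => (p.2.2 i).2)

/-- The inverse of `joinSurvey`, with a default value for a missing survey at the root. -/
def splitSurvey (y₀ : 𝒴) (w : Tree × (List ℕ → Unit ⊕ 𝒴)) :
    ℕ × 𝒴 × (ℕ → Tree × (List ℕ → Unit ⊕ 𝒴)) :=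
  (w.1 [], Sum.elim (fun _ => y₀) id (w.2 []),
    fun i => (fun v => w.1 (v ++ [i]), fun v => w.2 (v ++ [i])))

theorem splitSurvey_joinSurvey (y₀ : 𝒴) :
    Function.LeftInverse (splitSurvey y₀)
      (joinSurvey : _ → Tree × (List ℕ → Unit ⊕ 𝒴)) := fun p => by
  simp [splitSurvey, joinSurvey]

/-- As `joinSurvey`, with the spins of a level of the tree in addition. -/
def joinLevel (p : ℕ × 𝒴 × (ℕ → (List ℕ → Unit ⊕ ℤˣ) × Tree × (List ℕ → Unit ⊕ 𝒴))) :
    (List ℕ → Unit ⊕ ℤˣ) × Tree × (List ℕ → Unit ⊕ 𝒴) :=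
  (glue (Sum.inl ()) fun i => (p.2.2 i).1, joinSurvey (p.1, p.2.1, fun i => (p.2.2 i).2))

/-- The inverse of `joinLevel`. -/
def splitLevel (y₀ : 𝒴) (w : (List ℕ → Unit ⊕ ℤˣ) × Tree × (List ℕ → Unit ⊕ 𝒴)) :
    ℕ × 𝒴 × (ℕ → (List ℕ → Unit ⊕ ℤˣ) × Tree × (List ℕ → Unit ⊕ 𝒴)) :=
  ((splitSurvey y₀ w.2).1, (splitSurvey y₀ w.2).2.1,
    fun i => (fun v => w.1 (v ++ [i]), (splitSurvey y₀ w.2).2.2 i))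

theorem splitLevel_joinLevel (y₀ : 𝒴) : Function.LeftInverse (splitLevel y₀)
    (joinLevel : _ → (List ℕ → Unit ⊕ ℤˣ) × Tree × (List ℕ → Unit ⊕ 𝒴)) := fun p => by
  simp [splitLevel, joinLevel, splitSurvey_joinSurvey y₀ _]

theorem treeAndSurvey_succ (k : ℕ) (s : ℤˣ) (q : Seed 𝒴) :
    treeAndSurvey (k + 1) (mkSample s q) = joinSurvey (q.1 [], q.2.2 ([], s), fun i =>
      if i < q.1 [] then
        treeAndSurvey k (mkSample (s * (subSeed i q).2.1 []) (subSeed i q))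
      else ((subSeed i q).1, fun _ => Sum.inl ())) := by
  refine Prod.ext ?_ ?_
  · dsimp only [joinSurvey]
    refine eq_glue (y := q.1) rfl fun i v => ?_
    split_ifs <;> rfl
  · rw [joinSurvey]
    change restrictTo (truncation q.1 (k + 1)) (survey (mkSample s q)) = _
    rw [restrictTo_truncation_succ]
    simp only [survey_append]
    refine congrArg (glue _) (funext fun i => ?_)
    split_ifs <;> rfl

theorem levelSpins_succ (k : ℕ) (s : ℤˣ) (q : Seed 𝒴) :
    (levelSpins (k + 1) (mkSample s q), treeAndSurvey (k + 1) (mkSample s q)) =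
      joinLevel (q.1 [], q.2.2 ([], s), fun i => if i < q.1 [] then
        (levelSpins k (mkSample (s * (subSeed i q).2.1 []) (subSeed i q)),
          treeAndSurvey k (mkSample (s * (subSeed i q).2.1 []) (subSeed i q)))
      else (fun _ => Sum.inl (), (subSeed i q).1, fun _ => Sum.inl ())) := by
  refine Prod.ext ?_ ?_
  · rw [joinLevel]
    change restrictTo (levelSet q.1 (k + 1)) (spin (mkSample s q)) = _
    rw [restrictTo_levelSet_succ]
    simp only [spin_append]
    refine congrArg (glue _) (funext fun i => ?_)
    split_ifs <;> rfl
  · rw [treeAndSurvey_succ]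
    refine congrArg (fun z => joinSurvey (q.1 [], q.2.2 ([], s), z)) (funext fun i => ?_)
    dsimp only
    split_ifs <;> rfl

/-- The sign at the root, which no edge carries, does not influence the observation. -/
theorem treeAndSurvey_update (k : ℕ) (s x : ℤˣ) (q : Seed 𝒴) :
    treeAndSurvey k (mkSample s (q.1, Function.update q.2.1 [] x, q.2.2)) =
      treeAndSurvey k (mkSample s q) :=
  Prod.ext rfl (congrArg (restrictTo (truncation q.1 k)) (funext fun u => survey_update s x q u))

theorem levelSpins_update (k : ℕ) (s x : ℤˣ) (q : Seed 𝒴) :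
    levelSpins k (mkSample s (q.1, Function.update q.2.1 [] x, q.2.2)) =
      levelSpins k (mkSample s q) :=
  congrArg (restrictTo (levelSet q.1 k)) (funext fun u => spin_update s x q u)

variable [MeasurableSpace 𝒴]

theorem measurable_joinSurvey :
    Measurable (joinSurvey : _ → Tree × (List ℕ → Unit ⊕ 𝒴)) :=
  (measurable_glue (by fun_prop) (by fun_prop)).prodMk (measurable_glue
    (measurable_inr.comp (by fun_prop)) (by fun_prop))

theorem measurable_splitSurvey (y₀ : 𝒴) : Measurable (splitSurvey y₀) := by
  have : Measurable (Sum.elim (fun _ => y₀) id : Unit ⊕ 𝒴 → 𝒴) :=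
    measurable_const.sumElim measurable_id
  unfold splitSurvey
  fun_prop

theorem measurable_joinLevel :
    Measurable (joinLevel : _ → (List ℕ → Unit ⊕ ℤˣ) × Tree × (List ℕ → Unit ⊕ 𝒴)) :=
  (measurable_glue (by fun_prop) (by fun_prop)).prodMk (measurable_joinSurvey.comp (by fun_prop))

theorem measurable_splitLevel (y₀ : 𝒴) : Measurable (splitLevel y₀) := by
  have := measurable_splitSurvey y₀
  unfold splitLevel
  fun_prop

theorem measurable_levelSpins_prodMk (k : ℕ) :
    Measurable fun a : Sample 𝒴 => (levelSpins k a, treeAndSurvey k a) :=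
  (measurable_levelSpins k).prodMk (measurable_treeAndSurvey k)

theorem obsKernel_map_snd (M : TreeModel) {δ : ℝ} (W : Kernel ℤˣ 𝒴) (k : ℕ) :
    obsKernel M W δ (treeAndSurvey k) =
    (obsKernel M W δ fun a => (levelSpins k a, treeAndSurvey k a)).map Prod.snd := by
  ext1 s
  rw [Kernel.map_apply _ measurable_snd]
  exact (Measure.map_map measurable_snd
    ((measurable_levelSpins_prodMk k).comp (measurable_mkSample s))).symm

section

variable (M : TreeModel) {δ : ℝ} (W : Kernel ℤˣ 𝒴) [IsMarkovKernel W]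

theorem isStep_survey [IsProbabilityMeasure (signLaw δ)] (y₀ : 𝒴) (k : ℕ) :
    IsStep M δ W (obsKernel M W δ (treeAndSurvey k)) (obsKernel M W δ (treeAndSurvey (k + 1))) :=
  isStep_obsKernel M W (measurable_treeAndSurvey k) (treeAndSurvey_update k)
    (r := fun T => (T, fun _ => Sum.inl ())) (by fun_prop) measurable_joinSurvey
    (measurable_splitSurvey y₀) (splitSurvey_joinSurvey y₀) (treeAndSurvey_succ k)

theorem isStep_level [IsProbabilityMeasure (signLaw δ)] (y₀ : 𝒴) (k : ℕ) :
    IsStep M δ W (obsKernel M W δ fun a => (levelSpins k a, treeAndSurvey k a))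
      (obsKernel M W δ fun a => (levelSpins (k + 1) a, treeAndSurvey (k + 1) a)) :=
  isStep_obsKernel M W (measurable_levelSpins_prodMk k)
    (fun s x q => Prod.ext (levelSpins_update k s x q) (treeAndSurvey_update k s x q))
    (r := fun T => (fun _ => Sum.inl (), T, fun _ => Sum.inl ())) (by fun_prop) measurable_joinLevel
    (measurable_splitLevel y₀) (splitLevel_joinLevel y₀) (levelSpins_succ k)

/-- The survey at the root is a function of the observation up to level `0`. -/
theorem eq_obsKernel_map [IsProbabilityMeasure (signLaw δ)] (y₀ : 𝒴) :
    W = (obsKernel M W δ (treeAndSurvey 0)).map fun w => Sum.elim (fun _ => y₀) id (w.2 []) := by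
  have hm : Measurable fun w : Tree × (List ℕ → Unit ⊕ 𝒴) =>
      Sum.elim (fun _ => y₀) id (w.2 []) := (measurable_splitSurvey y₀).snd.fst
  ext1 s
  rw [Kernel.map_apply _ hm]
  change W s = ((seedLaw M δ W).map (treeAndSurvey 0 ∘ mkSample s)).map _
  rw [Measure.map_map hm ((measurable_treeAndSurvey 0).comp (measurable_mkSample s))]
  have hfun : (fun w : Tree × (List ℕ → Unit ⊕ 𝒴) => Sum.elim (fun _ => y₀) id (w.2 [])) ∘
      (treeAndSurvey 0 ∘ mkSample s) = (fun x => x ([], s)) ∘ Prod.snd ∘ Prod.snd := by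
    ext1 q
    have h : (treeAndSurvey 0 (mkSample s q)).2 [] = Sum.inr (q.2.2 ([], s)) :=
      restrictTo_of_mem (nil_mem_truncation _ _) _
    simp only [Function.comp_apply, h, Sum.elim_inr, id]
  rw [hfun, ← Measure.map_map (by fun_prop) (by fun_prop),
    ← Measure.map_map measurable_snd measurable_snd, seedLaw, Measure.map_snd_prod, measure_univ,
    one_smul, Measure.map_snd_prod, measure_univ, one_smul, Measure.infinitePi_map_eval]

theorem condEntropy_rootSpin {ζ : Type*} [MeasurableSpace ζ] (h0 : 0 ≤ δ) (h1 : δ ≤ 1)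
    {O : Sample 𝒴 → ζ} (hO : Measurable O) :
    condEntropy (botsMeasure M δ W) rootSpin O =
      biasMean (fun x => Real.binEntropy ((1 + x) / 2)) (obsKernel M W δ O) := by
  have := isProbabilityMeasure_signLaw h0 h1
  have := isProbabilityMeasure_botsMeasure M h0 h1 W
  have := isMarkovKernel_obsKernel M W (δ := δ) hO
  have hr : Measurable (rootSpin : Sample 𝒴 → ℤˣ) := measurable_spin []
  refine condEntropy_eq_biasMean _ hr hO _ fun s E hE => ?_
  have hk : obsKernel M W δ O s E = seedLaw M δ W (mkSample s ⁻¹' (O ⁻¹' E)) :=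
    Measure.map_apply (hO.comp (measurable_mkSample s)) hE
  have hpre : ∀ t, mkSample t ⁻¹' (rootSpin ⁻¹' {s} ∩ O ⁻¹' E) =
      if t = s then mkSample s ⁻¹' (O ⁻¹' E) else (∅ : Set (Seed 𝒴)) := fun t => by
    ext q
    have hq : rootSpin (mkSample t q) = t := rfl
    by_cases h : t = s
    · subst h; simp [hq]
    · simp [hq, h]
  rw [botsMeasure_apply M W ((hr .of_discrete).inter (hO hE)), hk, hpre, hpre]
  rcases Int.units_eq_one_or s with rfl | rfl
  · rw [if_pos rfl, if_neg (by decide), measure_empty, add_zero]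
  · rw [if_pos rfl, if_neg (by decide), measure_empty, zero_add]

theorem boundaryIrrelevance_of_lt (hW : probError W ≠ 1 / 2) (h0 : 0 ≤ δ) (h1 : δ ≤ 1)
    (h : M.degree * (1 - 2 * δ) ^ 2 * Real.exp (-(max (M.degree * (1 - 2 * δ) ^ 2 - 1) 0) / 2) *
      bhattacharyya W < 1) : BoundaryIrrelevance M δ W := by
  have := isProbabilityMeasure_signLaw h0 h1
  obtain ⟨y₀⟩ : Nonempty 𝒴 := (W 1).nonempty_of_neZero
  have hK : ∀ k, IsMarkovKernel (obsKernel M W δ (treeAndSurvey k)) := fun k =>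
    isMarkovKernel_obsKernel M W (measurable_treeAndSurvey k)
  have hL : ∀ k, IsMarkovKernel (obsKernel M W δ fun a => (levelSpins k a, treeAndSurvey k a)) :=
    fun k => isMarkovKernel_obsKernel M W (measurable_levelSpins_prodMk k)
  -- The survey at the root already carries some information.
  have hK0 : 0 < biasMean (fun x => x ^ 2) (obsKernel M W δ (treeAndSurvey 0)) := by
    have hW0 : 0 < biasMean (fun x => x ^ 2) W :=
      lt_of_le_of_ne (integral_nonneg fun y => sq_nonneg _) fun h =>
        hW (probError_eq_half W h.symm)
    refine hW0.trans_le ?_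
    have hm := (measurable_splitSurvey y₀).snd.fst
    have := biasMean_map_le (obsKernel M W δ (treeAndSurvey 0)) hm (continuous_pow 2)
      ((even_two.convexOn_pow).subset (Set.subset_univ _) (convex_Icc _ _))
    refine le_trans (le_of_eq ?_) this
    conv_lhs => rw [eq_obsKernel_map (δ := δ) M W y₀]
    rfl
  rw [bhattacharyya_eq_biasMean] at h
  have key := tendsto_biasMean_sqrt_sub h0 h1 (isStep_survey M W y₀) (isStep_level M W y₀)
    measurable_snd (obsKernel_map_snd M W) hK0 h
  have hh : Continuous fun x : ℝ => Real.binEntropy ((1 + x) / 2) :=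
    Real.binEntropy_continuous.comp (by fun_prop)
  have hs : Continuous fun x : ℝ => √(1 - x ^ 2) := by fun_prop
  have hI : ∀ k, condMutualInfo (botsMeasure M δ W) rootSpin (levelSpins k) (treeAndSurvey k) =
      biasMean (fun x => Real.binEntropy ((1 + x) / 2)) (obsKernel M W δ (treeAndSurvey k)) -
      biasMean (fun x => Real.binEntropy ((1 + x) / 2))
        (obsKernel M W δ fun a => (levelSpins k a, treeAndSurvey k a)) := fun k => by
    rw [condMutualInfo, condEntropy_rootSpin M W h0 h1 (measurable_treeAndSurvey k),
      condEntropy_rootSpin M W h0 h1 (measurable_levelSpins_prodMk k)]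
  -- The mutual information is squeezed between `0` and the gap of the Bhattacharyya coefficients.
  refine squeeze_zero (fun k => ?_) (fun k => ?_) key <;> rw [hI]
  · have := biasMean_map_le (obsKernel M W δ fun a => (levelSpins k a, treeAndSurvey k a))
      measurable_snd hh.neg convexOn_neg_binEntropy
    rw [← obsKernel_map_snd] at this
    simp only [biasMean, Pi.neg_apply, integral_neg] at this ⊢
    linarith
  · have := biasMean_map_le (obsKernel M W δ fun a => (levelSpins k a, treeAndSurvey k a))
      measurable_snd (hh.sub hs) convexOn_binEntropy_sub_sqrt
    rw [← obsKernel_map_snd] at this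
    have e1 := biasMean_sub hh hs (obsKernel M W δ (treeAndSurvey k))
    have e2 := biasMean_sub hh hs (obsKernel M W δ fun a => (levelSpins k a, treeAndSurvey k a))
    change biasMean (fun x => Real.binEntropy ((1 + x) / 2) - √(1 - x ^ 2)) _ ≤
      biasMean (fun x => Real.binEntropy ((1 + x) / 2) - √(1 - x ^ 2)) _ at this
    linarith

end

theorem bhattacharyya_le_one (W : Kernel ℤˣ 𝒴) [IsMarkovKernel W] : bhattacharyya W ≤ 1 := by
  rw [bhattacharyya_eq_biasMean]
  refine le_of_le_of_eq ?_ (biasMean_const 1 W)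
  exact biasMean_mono (by fun_prop) (by fun_prop)
    (fun x _ => Real.sqrt_le_one.2 (by nlinarith [sq_nonneg x])) W

/-! ### The critical value -/

theorem exp_mul_eq_one_iff {x : ℝ} (hx : 0 < x) :
    Real.exp (-(x - 1) / 2) * x = 1 ↔ Real.log x = (x - 1) / 2 := by
  rw [neg_div, Real.exp_neg, inv_mul_eq_one₀ (Real.exp_pos _).ne']
  exact ⟨fun h => by rw [← h, Real.log_exp, h], fun h => by rw [← h, Real.exp_log hx]⟩

/-- By strict concavity of the logarithm, `log x - (x - 1) / 2`, which vanishes at `1`, is positive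
between `1` and any larger point where it is nonnegative. -/
theorem half_lt_log {a b : ℝ} (ha : 1 < a) (hab : a < b) (hb : (b - 1) / 2 ≤ Real.log b) :
    (a - 1) / 2 < Real.log a := by
  have h := strictConcaveOn_log_Ioi.2 (Set.mem_Ioi.2 one_pos)
    (Set.mem_Ioi.2 (by linarith : 0 < b)) (by linarith : (1 : ℝ) ≠ b)
    (div_pos (by linarith) (by linarith) : 0 < (b - a) / (b - 1))
    (div_pos (by linarith) (by linarith) : 0 < (a - 1) / (b - 1)) (by
      have : b - 1 ≠ 0 := by linarith
      field_simp; ring)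
  have hb1 : 0 < b - 1 := by linarith
  have e : (b - a) / (b - 1) * 1 + (a - 1) / (b - 1) * b = a := by field_simp; ring
  simp only [smul_eq_mul, Real.log_one, mul_zero, zero_add] at h
  rw [e] at h
  refine lt_of_le_of_lt ?_ h
  calc (a - 1) / 2 = (a - 1) / (b - 1) * ((b - 1) / 2) := by field_simp
    _ ≤ _ := mul_le_mul_of_nonneg_left hb (div_nonneg (by linarith) hb1.le)

theorem exists_critical :
    ∃ α : ℝ, (3.5125 < α ∧ α < 3.5135) ∧ Real.log α = (α - 1) / 2 := by
  have h1 : (3.5125 - 1) / 2 < Real.log 3.5125 := by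
    rw [Real.lt_log_iff_exp_lt (by norm_num),
      show ((3.5125 : ℝ) - 1) / 2 = 1 + 0.25625 by norm_num, Real.exp_add]
    have e1 := Real.exp_one_lt_d9
    have e2 := Real.exp_bound' (x := 0.25625) (by norm_num) (by norm_num) (n := 6) (by norm_num)
    norm_num [Finset.sum_range_succ, Nat.factorial] at e2
    have e3 := Real.exp_pos 0.25625
    norm_num at e1 e2 e3 ⊢
    nlinarith
  have h2 : Real.log 3.5135 < (3.5135 - 1) / 2 := by
    rw [Real.log_lt_iff_lt_exp (by norm_num),
      show ((3.5135 : ℝ) - 1) / 2 = 1 + 0.25675 by norm_num, Real.exp_add]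
    have e1 := Real.exp_one_gt_d9
    have e2 := Real.sum_le_exp_of_nonneg (x := 0.25675) (by norm_num) 6
    norm_num [Finset.sum_range_succ, Nat.factorial] at e2
    norm_num at e1 e2 ⊢
    nlinarith
  have hc : ContinuousOn (fun x : ℝ => Real.log x - (x - 1) / 2) (Set.Icc 3.5125 3.5135) :=
    (Real.continuousOn_log.mono fun x hx => by
      have := hx.1
      simp only [Set.mem_compl_iff, Set.mem_singleton_iff]
      intro h; rw [h] at this; norm_num at this).sub (by fun_prop)
  obtain ⟨α, hα, h⟩ := intermediate_value_Ioo' (by norm_num) hc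
    (show (0 : ℝ) ∈ Set.Ioo _ _ from ⟨by linarith, by linarith⟩)
  exact ⟨α, hα, by linarith⟩

end

end BOTS

theorem theorem2 {𝒴 : Type*} [MeasurableSpace 𝒴] (W : Kernel ℤˣ 𝒴) [IsMarkovKernel W]
    (hW : BOTS.IsBMS W) (hW_nontrivial : BOTS.probError W ≠ 1 / 2)
    (δ θ : ℝ) (hδ_pos : 0 < δ) (hδ_le : δ ≤ 1 / 2) (hθ : θ = 1 - 2 * δ) :
    (∀ M : BOTS.TreeModel,
      M.degree * θ ^ 2 * Real.exp (-(max (M.degree * θ ^ 2 - 1) 0) / 2) * BOTS.bhattacharyya W < 1 →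
        BOTS.BoundaryIrrelevance M δ W) ∧
    ∃ α : ℝ, (1 < α ∧ Real.exp (-(α - 1) / 2) * α = 1) ∧
      (∀ β : ℝ, 1 < β → Real.exp (-(β - 1) / 2) * β = 1 → β = α) ∧
      |α - 3.513| < 0.0005 ∧
      ∀ M : BOTS.TreeModel, (M.degree * θ ^ 2 < 1 ∨ α < M.degree * θ ^ 2) →
        BOTS.BoundaryIrrelevance M δ W := by
  subst hθ
  have main : ∀ M : BOTS.TreeModel, M.degree * (1 - 2 * δ) ^ 2 *
      Real.exp (-(max (M.degree * (1 - 2 * δ) ^ 2 - 1) 0) / 2) * BOTS.bhattacharyya W < 1 →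
      BOTS.BoundaryIrrelevance M δ W := fun M h =>
    BOTS.boundaryIrrelevance_of_lt M W hW_nontrivial hδ_pos.le (by linarith) h
  refine ⟨main, ?_⟩
  obtain ⟨α, ⟨hα1, hα2⟩, hα⟩ := BOTS.exists_critical
  have h1 : 1 < α := by linarith
  refine ⟨α, ⟨h1, (BOTS.exp_mul_eq_one_iff (by linarith)).2 hα⟩, fun β hβ hβ' => ?_, ?_,
    fun M hM => main M ?_⟩
  · rw [BOTS.exp_mul_eq_one_iff (by linarith)] at hβ'
    rcases lt_trichotomy β α with h | h | h
    · exact absurd hβ' (BOTS.half_lt_log hβ h hα.ge).ne'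
    · exact h
    · exact absurd hα (BOTS.half_lt_log h1 h hβ'.ge).ne'
  · rw [abs_lt]; constructor <;> linarith
  · have hx0 : 0 ≤ M.degree * (1 - 2 * δ) ^ 2 := mul_nonneg M.degree_nonneg (sq_nonneg _)
    set x := M.degree * (1 - 2 * δ) ^ 2
    have hx : x * Real.exp (-(max (x - 1) 0) / 2) < 1 := by
      rcases hM with h | h
      · rw [max_eq_right (by linarith)]; simpa using h
      · rw [max_eq_left (by linarith)]
        have hlt : Real.log x < (x - 1) / 2 := by
          by_contra! hc
          exact absurd hα (BOTS.half_lt_log h1 h hc).ne'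
        rw [Real.log_lt_iff_lt_exp (by linarith)] at hlt
        rwa [neg_div, Real.exp_neg, mul_inv_lt_iff₀ (Real.exp_pos _), one_mul]
    refine lt_of_le_of_lt (mul_le_of_le_one_right ?_ (BOTS.bhattacharyya_le_one W)) hx
    positivity
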